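/- A strict partition is a finite strictly decreasing sequence $\lambda=(\lambda_1>\lambda_2>\dots>\lambda_{\ell}>0)$ of positive integers (possibly empty); $\ell(\lambda)=\ell$ is its number of parts, and $\lambda_i:=0$ for $i>\ell$. Its shifted diagram is $\mathsf{SD}_\lambda=\{(i,j)\in\mathbb Z\times\mathbb Z: 0<i\le j<i+\lambda_i\}$, and $|\lambda|=|\mathsf{SD}_\lambda|$. For strict partitions, $\mu\subseteq\lambda$ means $\mu_i\le\lambda_i$ for all $i$; then $\mathsf{SD}_{\lambda/\mu}=\mathsf{SD}_\lambda\setminus\mathsf{SD}_\mu$, $|\lambda/\mu|=|\mathsf{SD}_{\lambda/\mu}|$, and $\mathsf{cols}(\lambda/\mu)$ is the number of distinct columns $j$ for which $(i,j)\in\mathsf{SD}_{\lambda/\mu}$ for some $i$. Write $i'=i-\tfrac12$. A semistandard set-valued shifted tableau $T$ of shape $\lambda$ assigns to each $(i,j)\in\mathsf{SD}_\lambda$ a nonempty finite subset $T_{ij}$ of $\{1'<1<2'<2<\cdots\}$ such that rows and columns are weakly increasing (a sequence of sets $S_1,S_2,\dots$ being weakly increasing if $\max S_k\le\min S_{k+1}$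 for all $k$), no unprimed number occurs more than once in a given column, and no primed number occurs more than once in a given row. Let $\mathrm{SetShYT}_Q(\lambda)$ be the set of all these tableaux and $\mathrm{SetShYT}_P(\lambda)$ the subset of those with no primed number in any diagonal position $(j,j)$. Put $|T|=\sum_{(i,j)}|T_{ij}|$ and $x^T=\prod_{i\ge1}x_i^{m_i}$, where $m_i$ is the number of times $i$ or $i'$ occurs in $T$. The $K$-theoretic Schur $P$- and $Q$-functions are the power series in $\mathbb Z[\beta][[x_1,x_2,\dots]]$ $$GP_\lambda=\sum_{T\in\mathrm{SetShYT}_P(\lambda)}\beta^{|T|-|\lambda|}x^T,\qquad GQ_\lambda=\sum_{T\in\mathrm{SetShYT}_Q(\lambda)}\beta^{|T|-|\lambda|}x^T.$$ **Theorem.** For every strict partition $\mu$, $$GQ_\mu=2^{\ell(\mu)}\sum_{\lambda}(-1)^{\mathsf{cols}(\lambda/\mu)}\,(-\beta/2)^{|\lambda/\mu|}\,GP_\lambda,$$ where the (finite) sum is over all strict partitions $\lambda\supseteq\mu$ with $\ell(\lambda)=\ell(\mu)$ such that $\mathsf{SD}_{\lambda/\mu}$ is a vertical strip, that is, a set with at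 most one position in each row. -/

import Mathlib

noncomputable section

/-- A strict partition: a finite strictly decreasing sequence of positive integers. -/
@[ext]
structure StrictPartition where
  /-- the parts, listed from the largest to the smallest -/
  parts : List ℕ
  strictAnti : parts.Pairwise (· > ·)
  pos : ∀ p ∈ parts, 0 < p

namespace StrictPartition

/-- The number `ℓ(lam)` of parts. -/
def length (lam : StrictPartition) : ℕ := lam.parts.length

/-- The part with (zero-based) index `i`, equal to `0` when `i ≥ ℓ(lam)`. -/
def part (lam : StrictPartition) (i : ℕ) : ℕ := lam.parts.getD i 0

/-- The shifted diagram, with rows and columns numbered from `0`: the boxes `(i, j)` with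
`i ≤ j < i + lam_i`. (Numbering from `1` moves every box by `(1, 1)`.) -/
def diagram (lam : StrictPartition) : Finset (ℕ × ℕ) :=
  (Finset.range lam.length).biUnion fun i =>
    (Finset.Ico i (i + lam.part i)).image fun j => (i, j)

theorem mem_diagram (lam : StrictPartition) (i j : ℕ) :
    (i, j) ∈ lam.diagram ↔ i ≤ j ∧ j < i + lam.part i := by
  simp only [diagram, Finset.mem_biUnion, Finset.mem_range, Finset.mem_image, Finset.mem_Ico,
    Prod.mk.injEq]
  constructor
  · rintro ⟨a, _, b, hb, rfl, rfl⟩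
    exact hb
  · rintro ⟨h1, h2⟩
    refine ⟨i, ?_, j, ⟨h1, h2⟩, rfl, rfl⟩
    by_contra h
    have : lam.part i = 0 := List.getD_eq_default _ _ (not_lt.mp h)
    omega

/-- Containment `mu ⊆ lam`, meaning `mu_i ≤ lam_i` for all `i`. -/
instance : HasSubset StrictPartition := ⟨fun mu lam => ∀ i, mu.part i ≤ lam.part i⟩

/-- The shifted skew diagram of `lam / mu`. -/
def skewDiagram (lam mu : StrictPartition) : Finset (ℕ × ℕ) := lam.diagram \ mu.diagram

/-- The number of distinct columns occupied by the boxes of `lam / mu`. -/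
def cols (lam mu : StrictPartition) : ℕ := ((skewDiagram lam mu).image Prod.snd).card

/-- A set of boxes is a vertical strip when it has at most one box in each row. -/
def IsVerticalStrip (D : Finset (ℕ × ℕ)) : Prop :=
  ∀ i j₁ j₂ : ℕ, (i, j₁) ∈ D → (i, j₂) ∈ D → j₁ = j₂

/-- The strict partitions `lam ⊇ mu` with `ℓ(lam) = ℓ(mu)` for which the shifted skew diagram of
`lam / mu` is a vertical strip. -/
def verticalStripExtensions (mu : StrictPartition) : Set StrictPartition :=
  {lam | mu ⊆ lam ∧ lam.length = mu.length ∧ IsVerticalStrip (skewDiagram lam mu)}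

end StrictPartition

/-- The positive half-integers `1' < 1 < 2' < 2 < ⋯`, where `i' = i - 1/2`, are encoded as the
natural numbers `0 < 1 < 2 < 3 < ⋯`: the number `k` stands for `(k + 1) / 2`.
Thus `k` stands for a primed number exactly when it is even. -/
def IsPrimed (k : ℕ) : Prop := Even k

/-- The index of the variable contributed by the entry encoded by `k`. Variables are numbered from
`0`, so the entries `i'` and `i`, encoded as `2 * (i - 1)` and `2 * (i - 1) + 1`,
both have index `i - 1`. -/
def varIndex (k : ℕ) : ℕ := k / 2

/-- A semistandard set-valued shifted tableau of shape `lam` (a set-valued `Q`-shifted tableau):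
a filling of the boxes of the shifted diagram by nonempty finite sets of positive half-integers.
The filling is extended by the empty set outside of the diagram. -/
@[ext]
structure SetShYT (lam : StrictPartition) where
  entry : ℕ → ℕ → Finset ℕ
  nonempty_iff : ∀ i j, (entry i j).Nonempty ↔ (i, j) ∈ lam.diagram
  /-- rows are weakly increasing -/
  row_weak : ∀ i j₁ j₂, j₁ < j₂ → ∀ a ∈ entry i j₁, ∀ b ∈ entry i j₂, a ≤ b
  /-- columns are weakly increasing -/
  col_weak : ∀ i₁ i₂ j, i₁ < i₂ → ∀ a ∈ entry i₁ j, ∀ b ∈ entry i₂ j, a ≤ b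
  /-- no unprimed number occurs more than once in a column -/
  col_unprimed : ∀ i₁ i₂ j a, ¬ IsPrimed a → a ∈ entry i₁ j → a ∈ entry i₂ j → i₁ = i₂
  /-- no primed number occurs more than once in a row -/
  row_primed : ∀ i j₁ j₂ a, IsPrimed a → a ∈ entry i j₁ → a ∈ entry i j₂ → j₁ = j₂

namespace SetShYT

variable {lam : StrictPartition}

/-- A set-valued `P`-shifted tableau has no primed number in a diagonal box. -/
def IsP (T : SetShYT lam) : Prop := ∀ i, ∀ a ∈ T.entry i i, ¬ IsPrimed a

/-- The exponent vector of the monomial `x^T`. -/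
def weight (T : SetShYT lam) : ℕ →₀ ℕ :=
  ∑ p ∈ lam.diagram, ∑ a ∈ T.entry p.1 p.2, Finsupp.single (varIndex a) 1

/-- The total number `|T|` of entries. -/
def size (T : SetShYT lam) : ℕ := ∑ p ∈ lam.diagram, (T.entry p.1 p.2).card

theorem card_diagram_le_size (T : SetShYT lam) : lam.diagram.card ≤ T.size := by
  rw [Finset.card_eq_sum_ones]
  exact Finset.sum_le_sum fun p hp => Finset.card_pos.mpr ((T.nonempty_iff p.1 p.2).mpr hp)

/-- Only finitely many tableaux have a given weight, so that the sums below are genuine. -/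
theorem finite_weight (d : ℕ →₀ ℕ) : {T : SetShYT lam | T.weight = d}.Finite := by
  classical
  set N := 2 * d.support.sup id + 2 with hN
  have key : ∀ T : SetShYT lam, T.weight = d → ∀ i j, T.entry i j ⊆ Finset.range N := by
    intro T hT i j a ha
    have hij : (i, j) ∈ lam.diagram := (T.nonempty_iff i j).mp ⟨a, ha⟩
    have h1 : varIndex a ∈ d.support := by
      rw [Finsupp.mem_support_iff, ← hT, weight, Finsupp.finsetSum_apply]
      intro h0
      have h2 := (Finset.sum_eq_zero_iff.mp h0) (i, j) hij
      rw [Finsupp.finsetSum_apply] at h2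
      have h3 := (Finset.sum_eq_zero_iff.mp h2) a ha
      simp at h3
    have h4 : varIndex a ≤ d.support.sup id := Finset.le_sup (f := id) h1
    rw [Finset.mem_range]
    unfold varIndex at h4
    omega
  let f : SetShYT lam → (lam.diagram → Finset ℕ) := fun T p => T.entry p.1.1 p.1.2
  have hf : Function.Injective f := by
    intro T U h
    ext1
    funext i j
    by_cases hij : (i, j) ∈ lam.diagram
    · exact congrFun h ⟨(i, j), hij⟩
    · have hT := mt (T.nonempty_iff i j).mp hij
      have hU := mt (U.nonempty_iff i j).mp hij
      rw [Finset.not_nonempty_iff_eq_empty] at hT hU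
      rw [hT, hU]
  refine Set.Finite.of_finite_image (f := f) ?_ hf.injOn
  refine (Set.Finite.pi' (t := fun _ : lam.diagram =>
    ((Finset.range N).powerset : Set (Finset ℕ))) fun _ => Finset.finite_toSet _).subset ?_
  rintro _ ⟨T, hT, rfl⟩ p
  exact Finset.mem_coe.mpr (Finset.mem_powerset.mpr (key T hT p.1.1 p.1.2))

end SetShYT

/-- The generating function `∑ β^(|T| - |lam|) x^T` over a set `S` of set-valued tableaux of
shape `lam`, a power series in `x_1, x_2, …` over `ℤ[β]` (the polynomial variable is `β`). The
coefficient of the monomial with exponent vector `d` is the (finite) sum of `β^(|T| - |lam|)`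
over the tableaux `T` in `S` of weight `d`. -/
def tableauSeries {lam : StrictPartition} (S : Set (SetShYT lam)) :
    MvPowerSeries ℕ (Polynomial ℤ) := fun d =>
  ∑ᶠ T ∈ {T : SetShYT lam | T ∈ S ∧ T.weight = d},
    (Polynomial.X : Polynomial ℤ) ^ (T.size - lam.diagram.card)

/-- The `K`-theoretic Schur `P`-function. -/
def GP (lam : StrictPartition) : MvPowerSeries ℕ (Polynomial ℤ) :=
  tableauSeries {T : SetShYT lam | T.IsP}

/-- The `K`-theoretic Schur `Q`-function. -/
def GQ (lam : StrictPartition) : MvPowerSeries ℕ (Polynomial ℤ) :=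
  tableauSeries (Set.univ : Set (SetShYT lam))

/-- The inclusion of `ℤ[β][[x_1, x_2, …]]` into `ℚ[β][[x_1, x_2, …]]`. -/
def toRat : MvPowerSeries ℕ (Polynomial ℤ) →+* MvPowerSeries ℕ (Polynomial ℚ) :=
  MvPowerSeries.map (Polynomial.mapRingHom (Int.castRingHom ℚ))

/-- The polynomial `-β/2` in `ℚ[β]`. -/
def negHalfBeta : Polynomial ℚ := Polynomial.C (-1 / 2) * Polynomial.X

end

/-! Work with finitely many variables and build tableaux one variable at a time. Passing from shape
nu to shape lam by adding the two letters N' and N has a total weight V_d(lam, nu), which is a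
product over the rows (`boundedSeries_add_two`). The flag d says whether primed diagonal entries are
allowed, so d = true builds `GQ` and d = false builds `GP`. The claimed coefficient S(mu, lam) is
also a product of row factors: 2 for an unchanged row, β for a row whose new box is the lowest in
its column, -β for any other new box (`prod_stripRow_eq`); in this form it has no denominators. The
theorem follows by induction on the number of variables (`boundedSeries_true_eq_sum`) from the
relation V_true S = S V_false between matrices indexed by strict partitions (`intertwining`), since
each coefficient of the series involves only finitely many variables.

At a fixed entry (mu, ka), both sides of this relation are sums of products of factors that couple
consecutive rows, so they are transfer-matrix sums (`chainSum`), evaluated from the last row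
upwards. The partial sums are indexed by the length of the current row, which is ka_i or ka_i - 1 on
the left and mu_i or mu_i + 1 on the right. Hence only four numbers L0, L1, R0, R1 matter. The
desired equality L0 + L1 = R0 + R1 does not propagate alone, because the factor of the next row
depends on which length occurred below it. `RowRelation` adds enough linear relations, with
coefficients polynomial in β * x, to be preserved at every row (`rowRelation_step`); this is a
finite check over the relative positions of the parts. -/

/-! ### Row weights and the invariant of the transfer-matrix recursion. -/

section RowWeights

variable {R : Type*} [CommRing R] (x β : R)

/-- The weight of a row for a primed letter: it is the sum of `x ^ (r - k) * β ^ (n - k)` over the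
possible lengths `k` of the part without the letter, where the row grows from length `n` to length
`r` and the next row had length `n1`. Primed letters are allowed on the diagonal if `d` is true. -/
def primedRow (d : Bool) (n n1 r : ℕ) : R :=
  if r = n then 1 + (if n1 + 1 < n ∨ (d = true ∧ n = 1) then β * x else 0)
  else if r = n + 1 ∧ (d = true ∨ 0 < n) then x else 0

/-- The weight of a row for an unprimed letter, where the row grows from length `r` to length `l`
and the next row grows to length `l1`. -/
def unprimedRow (l l1 r : ℕ) : R :=
  if r ≤ l ∧ (l1 < r ∨ l1 = 0) then
    x ^ (l - r) * (1 + (if 0 < r ∧ (l1 + 1 < r ∨ l1 = 0) then β * x else 0))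
  else 0

/-- The weight of a row for a primed letter followed by the unprimed one, where the rows grow from
lengths `n, n1` to lengths `l, l1`. -/
def variableRow (d : Bool) (l l1 n n1 : ℕ) : R :=
  primedRow x β d n n1 n * unprimedRow x β l l1 n +
    primedRow x β d n n1 (n + 1) * unprimedRow x β l l1 (n + 1)

/-- The factor of a row in the coefficient of `GP_lam` in `GQ_mu`, where `m, m1` and `l, l1` are
consecutive parts of `mu` and `lam`. -/
def stripRow (m m1 l l1 : ℕ) : R :=
  if m = 0 then (if l = 0 then 1 else 0)
  else if m ≤ m1 then 0
  else if l1 = m1 + 1 ∧ m = m1 + 1 then (if l = m + 1 then -β else 0)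
  else if l = m + 1 then β else if l = m then 2 else 0

/-- The relation between the partial sums over the rows below a row of lengths `m` in `mu` and `k`
in `ka`. The sums `L0, L1` belong to the rows of lengths `k, k - 1` in `nu`, and `R0, R1` to the rows
of lengths `m, m + 1` in `lam`. -/
def RowRelation (m k : ℕ) (L0 L1 R0 R1 : R) : Prop :=
  (k ≤ 1 → L1 = 0) ∧ (m = 0 → R1 = 0) ∧ (m + 1 = k → L0 = 0 ∧ R0 = 0) ∧
  (m + 1 < k → L0 = 0 ∧ L1 = 0 ∧ R0 = 0 ∧ R1 = 0) ∧
  L0 + L1 = R0 + R1 ∧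
  (k < m → β * x * R0 = 2 * R1) ∧
  (0 < k → m = k → (1 + β * x) * (2 + β * x) * R0 = (2 + β * x) * L0 + 2 * (1 + β * x) * L1)

theorem variableRow_of_lt (d : Bool) {l l1 n n1 : ℕ} (h : l < n) :
    variableRow x β d l l1 n n1 = 0 := by
  have a : ¬ n ≤ l := by omega
  have b : ¬ n + 1 ≤ l := by omega
  simp [variableRow, unprimedRow, a, b]

theorem variableRow_of_gt (d : Bool) {l l1 n n1 : ℕ} (h : n < l1) :
    variableRow x β d l l1 n n1 = 0 := by
  have a : ¬ l1 < n := by omega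
  have b : ¬ l1 < n + 1 := by omega
  have c : ¬ l1 = 0 := by omega
  simp [variableRow, unprimedRow, a, b, c]

theorem variableRow_self (d : Bool) {l1 n n1 : ℕ} (hn : 0 < n) (h : l1 < n) :
    variableRow x β d n l1 n n1 =
      (1 + if n1 + 1 < n ∨ (d = true ∧ n = 1) then β * x else 0) *
      (1 + if l1 + 1 < n ∨ l1 = 0 then β * x else 0) := by
  simp [variableRow, unprimedRow, primedRow, h, hn]

/-- The intermediate lengths n and n + 1 both give the power x ^ (l - n): the second takes its first
factor x from a primed letter. This is the source of the 2. If the next row comes closer, the length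
n first loses its factor 1 + β * x (`variableRow_near`) and is then excluded (`variableRow_touch`).
-/
theorem variableRow_far (d : Bool) {l l1 n n1 : ℕ} (hn : 0 < n) (hl : n < l)
    (h : l1 + 1 < n ∨ l1 = 0) :
    variableRow x β d l l1 n n1 = x ^ (l - n) * (1 + β * x) *
      (2 + if n1 + 1 < n ∨ (d = true ∧ n = 1) then β * x else 0) := by
  have a : l1 < n ∨ l1 = 0 := by omega
  have b : l1 ≤ n := by omega
  obtain ⟨e, rfl⟩ : ∃ e, l = n + 1 + e := ⟨l - n - 1, by omega⟩
  have e1 : n + 1 + e - n = e + 1 := by omega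
  simp [variableRow, unprimedRow, primedRow, h, hn, a, b, e1, hl.le]
  ring

theorem variableRow_near (d : Bool) {l l1 n n1 : ℕ} (hl : n < l) (h1 : 0 < l1)
    (h : l1 + 1 = n) :
    variableRow x β d l l1 n n1 = x ^ (l - n) *
      (2 + β * x + if n1 + 1 < n ∨ (d = true ∧ n = 1) then β * x else 0) := by
  subst h
  obtain ⟨e, rfl⟩ : ∃ e, l = l1 + 1 + 1 + e := ⟨l - l1 - 1 - 1, by omega⟩
  have e1 : l1 + 1 + 1 + e - (l1 + 1) = e + 1 := by omega
  have h0 : l1 ≠ 0 := by omega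
  simp [variableRow, unprimedRow, primedRow, hl.le, e1, h0]
  ring

theorem variableRow_touch (d : Bool) {l l1 n n1 : ℕ} (hn : 0 < n) (hl : n < l) (h : l1 = n) :
    variableRow x β d l l1 n n1 = x ^ (l - n) := by
  subst l1
  obtain ⟨e, rfl⟩ : ∃ e, l = n + 1 + e := ⟨l - n - 1, by omega⟩
  have e1 : n + 1 + e - n = e + 1 := by omega
  have h0 : n ≠ 0 := by omega
  simp [variableRow, unprimedRow, primedRow, hn, e1, h0]
  ring

/-- A new row may start with a primed letter only if `d` is true; the extra term is x * x ^ (l - 1)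
* (1 + β * x). -/
theorem variableRow_zero (d : Bool) {l : ℕ} :
    variableRow x β d l 0 0 0 =
      if l = 0 then 1 else if d = true then x ^ l * (2 + β * x) else x ^ l := by
  rcases l with _ | l
  · simp [variableRow, unprimedRow, primedRow]
  · cases d <;> simp [variableRow, unprimedRow, primedRow]
    ring

theorem variableRow_zero' (d : Bool) {l l1 n1 : ℕ} (h : l1 ≠ 0) :
    variableRow x β d l l1 0 n1 = 0 := variableRow_of_gt x β d (by omega)

/-- Comparing m with k leaves five regimes. Each is packaged as a position and two algebraic facts,
so that one pattern destructs them all. -/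
theorem RowRelation.cases {m k : ℕ} {L0 L1 R0 R1 : R} (h : RowRelation x β m k L0 L1 R0 R1) :
    (m + 1 < k ∧ (L0 = 0 ∧ L1 = 0) ∧ R0 = 0 ∧ R1 = 0) ∨
    (m + 1 = k ∧ (L0 = 0 ∧ R0 = 0) ∧ L1 = R1) ∨
    ((m = k ∧ 0 < k) ∧ L0 + L1 = R0 + R1 ∧
      (1 + β * x) * (2 + β * x) * R0 = (2 + β * x) * L0 + 2 * (1 + β * x) * L1) ∨
    (k < m ∧ L0 + L1 = R0 + R1 ∧ β * x * R0 = 2 * R1) ∨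
    ((m = 0 ∧ k = 0) ∧ (L1 = 0 ∧ R1 = 0) ∧ L0 = R0) := by
  obtain ⟨g1, g2, g3, g4, g5, g6, g7⟩ := h
  rcases lt_trichotomy m k with a | a | a
  · rcases (show m + 1 < k ∨ m + 1 = k by omega) with b | b
    · grind
    · grind
  · rcases Nat.eq_zero_or_pos k with b | b
    · grind
    · grind
  · grind

-- Here both middle lengths are forced: nu has m = k - 1 in this row and lam has m + 1 = k. Only the
-- equality of L1 and R1 has content.
set_option maxHeartbeats 2000000 in
theorem rowRelation_step_below {m m1 k k1 : ℕ}
    (hm : m1 < m) (hk : k1 < k) (hmk : m + 1 = k) (L0 L1 R0 R1 : R)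
    (g : RowRelation x β m1 k1 L0 L1 R0 R1) :
    RowRelation x β m k
      (variableRow x β true m m1 k k1 * 2 * L0 +
        variableRow x β true m m1 k (k1 - 1) * 2 * L1)
      (variableRow x β true m m1 (k - 1) k1 * stripRow β (k - 1) k1 k k1 * L0 +
        variableRow x β true m m1 (k - 1) (k1 - 1) * stripRow β (k - 1) (k1 - 1) k k1 * L1)
      (2 * variableRow x β false m m1 k k1 * R0 +
        stripRow β m m1 m (m1 + 1) * variableRow x β false m (m1 + 1) k k1 * R1)
      (β * variableRow x β false (m + 1) m1 k k1 * R0 +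
        stripRow β m m1 (m + 1) (m1 + 1) * variableRow x β false (m + 1) (m1 + 1) k k1 * R1) := by
  obtain ⟨z1, -⟩ := id g
  -- The trivial equation `R0 = R0` supplies an `e1` in both branches, so one tactic block, ending
  -- with algebra from `e1`, `e5`, `e6` alone, serves every case.
  have z1 : (1 < k1 ∧ R0 = R0) ∨ (k1 ≤ 1 ∧ L1 = 0) := by by_cases h : k1 ≤ 1 <;> grind
  subst hmk
  rcases z1 with ⟨z1, e1⟩ | ⟨z1, e1⟩ <;>
    rcases g.cases with ⟨c9, e5, e6⟩ | ⟨c9, e5, e6⟩ | ⟨c9, e5, e6⟩ | ⟨c9, e5, e6⟩ |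
      ⟨c9, e5, e6⟩ <;>
    rcases (show m = k1 ∨ m = k1 + 1 ∨ k1 + 1 < m by omega) with c4 | c4 | c4 <;>
    rcases (show (m = m1 + 1 ∧ 0 < m1) ∨ (m = m1 + 1 ∧ m1 = 0) ∨ m1 + 1 < m by omega)
      with c7 | c7 | c7 <;>
    simp only [Nat.add_sub_cancel] <;>
    first
    | (exfalso; omega)
    | (simp (disch := omega) only [variableRow_of_lt, variableRow_self, if_neg, if_pos, stripRow, true_and,
        false_and, or_false, ite_true, eq_self, reduceCtorEq]
       refine ⟨fun h => ?_, fun h => ?_, fun h => ?_, fun h => ?_, ?_, fun h => ?_,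
         fun h h' => ?_⟩ <;>
       first
       | (exfalso; omega)
       | (clear * - e1 e5 e6; grind))

-- All four partial sums can be nonzero here, so a second relation besides equality of totals must
-- be carried: the last clause of `RowRelation`.
set_option maxHeartbeats 2000000 in
theorem rowRelation_step_equal {m m1 k k1 : ℕ}
    (hm : m1 < m) (hk : k1 < k) (hmk : m = k) (L0 L1 R0 R1 : R)
    (g : RowRelation x β m1 k1 L0 L1 R0 R1) :
    RowRelation x β m k
      (variableRow x β true m m1 k k1 * 2 * L0 +
        variableRow x β true m m1 k (k1 - 1) * 2 * L1)
      (variableRow x β true m m1 (k - 1) k1 * stripRow β (k - 1) k1 k k1 * L0 +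
        variableRow x β true m m1 (k - 1) (k1 - 1) * stripRow β (k - 1) (k1 - 1) k k1 * L1)
      (2 * variableRow x β false m m1 k k1 * R0 +
        stripRow β m m1 m (m1 + 1) * variableRow x β false m (m1 + 1) k k1 * R1)
      (β * variableRow x β false (m + 1) m1 k k1 * R0 +
        stripRow β m m1 (m + 1) (m1 + 1) * variableRow x β false (m + 1) (m1 + 1) k k1 * R1) := by
  obtain ⟨z1, -⟩ := id g
  have z1 : (1 < k1 ∧ R0 = R0) ∨ (k1 ≤ 1 ∧ L1 = 0) := by by_cases h : k1 ≤ 1 <;> grind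
  subst hmk
  have p1 : x ^ (m - (m - 1)) = x := by rw [show m - (m - 1) = 1 by omega, pow_one]
  have p2 : x ^ (m + 1 - m) = x := by rw [show m + 1 - m = 1 by omega, pow_one]
  rcases z1 with ⟨z1, e1⟩ | ⟨z1, e1⟩ <;>
    rcases g.cases with ⟨c9, e5, e6⟩ | ⟨c9, e5, e6⟩ | ⟨c9, e5, e6⟩ | ⟨c9, e5, e6⟩ |
      ⟨c9, e5, e6⟩ <;>
    rcases (show m = k1 + 1 ∨ m = k1 + 2 ∨ k1 + 2 < m by omega) with c4 | c4 | c4 <;>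
    rcases (show m1 + 2 = m ∨ m1 + 2 < m ∨ (m = m1 + 1 ∧ 0 < m1) ∨ (m = m1 + 1 ∧ m1 = 0) by omega)
      with c8 | c8 | c8 | c8 <;>
    first
    | (exfalso; omega)
    | (simp (disch := omega) only [variableRow_touch, variableRow_self, if_neg, if_pos, stripRow, variableRow_far,
        variableRow_near, true_and, false_and, or_false, ite_true, eq_self,
        reduceCtorEq, p1, p2]
       refine ⟨fun h => ?_, fun h => ?_, fun h => ?_, fun h => ?_, ?_, fun h => ?_,
         fun h h' => ?_⟩ <;>
       first
       | (exfalso; omega)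
       | (clear * - e1 e5 e6; grind))

set_option maxHeartbeats 2000000 in
theorem rowRelation_step_above {m m1 k k1 : ℕ}
    (hm : m1 < m) (hk : k1 < k) (hmk : k < m) (L0 L1 R0 R1 : R)
    (g : RowRelation x β m1 k1 L0 L1 R0 R1) :
    RowRelation x β m k
      (variableRow x β true m m1 k k1 * 2 * L0 +
        variableRow x β true m m1 k (k1 - 1) * 2 * L1)
      (variableRow x β true m m1 (k - 1) k1 * stripRow β (k - 1) k1 k k1 * L0 +
        variableRow x β true m m1 (k - 1) (k1 - 1) * stripRow β (k - 1) (k1 - 1) k k1 * L1)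
      (2 * variableRow x β false m m1 k k1 * R0 +
        stripRow β m m1 m (m1 + 1) * variableRow x β false m (m1 + 1) k k1 * R1)
      (β * variableRow x β false (m + 1) m1 k k1 * R0 +
        stripRow β m m1 (m + 1) (m1 + 1) * variableRow x β false (m + 1) (m1 + 1) k k1 * R1) := by
  obtain ⟨z1, -⟩ := id g
  have z1 : (1 < k1 ∧ R0 = R0) ∨ (k1 ≤ 1 ∧ L1 = 0) := by by_cases h : k1 ≤ 1 <;> grind
  -- Every nonzero weight contains this power; naming it removes symbolic exponents from the
  -- identities left to `grind`.
  obtain ⟨p, p0⟩ : ∃ p, x ^ (m - k) = p := ⟨_, rfl⟩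
  have p1 : x ^ (m - (k - 1)) = p * x := by rw [← p0, ← pow_succ]; congr 1; omega
  have p2 : x ^ (m + 1 - k) = p * x := by rw [← p0, ← pow_succ]; congr 1; omega
  rcases z1 with ⟨z1, e1⟩ | ⟨z1, e1⟩ <;>
    rcases g.cases with ⟨c9, e5, e6⟩ | ⟨c9, e5, e6⟩ | ⟨c9, e5, e6⟩ | ⟨c9, e5, e6⟩ |
      ⟨c9, e5, e6⟩ <;>
    rcases (show k = k1 + 1 ∨ k = k1 + 2 ∨ k1 + 2 < k by omega) with c4 | c4 | c4 <;>
    rcases (show m1 + 2 < k ∨ m1 + 2 = k ∨ (m1 + 1 = k ∧ 0 < m1) ∨ (m1 + 1 = k ∧ m1 = 0) ∨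
      m1 = k ∨ k < m1 by omega) with c8 | c8 | c8 | c8 | c8 | c8 <;>
    rcases (show m = m1 + 1 ∨ m1 + 1 < m by omega) with c7 | c7 <;>
    first
    | (exfalso; omega)
    | (simp (disch := omega) only [variableRow_of_gt, variableRow_touch, if_neg, if_pos, stripRow,
        variableRow_far, variableRow_near, true_and, false_and, or_false, ite_true,
        eq_self, reduceCtorEq, p0, p1, p2]
       refine ⟨fun h => ?_, fun h => ?_, fun h => ?_, fun h => ?_, ?_, fun h => ?_,
         fun h h' => ?_⟩ <;>
       first
       | (exfalso; omega)
       | (clear * - e1 e5 e6; grind))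

theorem rowRelation_step {m m1 k k1 : ℕ}
    (hm : m1 ≤ m - 1) (hk : k1 ≤ k - 1) (L0 L1 R0 R1 : R)
    (h : RowRelation x β m1 k1 L0 L1 R0 R1) :
    RowRelation x β m k
      (variableRow x β true m m1 k k1 * stripRow β k k1 k k1 * L0 +
        variableRow x β true m m1 k (k1 - 1) * stripRow β k (k1 - 1) k k1 * L1)
      (if k = 0 then 0 else (variableRow x β true m m1 (k - 1) k1 * stripRow β (k - 1) k1 k k1 * L0 +
        variableRow x β true m m1 (k - 1) (k1 - 1) * stripRow β (k - 1) (k1 - 1) k k1 * L1))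
      (stripRow β m m1 m m1 * variableRow x β false m m1 k k1 * R0 +
        stripRow β m m1 m (m1 + 1) * variableRow x β false m (m1 + 1) k k1 * R1)
      (stripRow β m m1 (m + 1) m1 * variableRow x β false (m + 1) m1 k k1 * R0 +
        stripRow β m m1 (m + 1) (m1 + 1) * variableRow x β false (m + 1) (m1 + 1) k k1 * R1) := by
  rcases Nat.eq_zero_or_pos k with rfl | hk0
  · obtain rfl : k1 = 0 := by omega
    obtain ⟨g1, g2, -, -, g5, -⟩ := h
    obtain rfl : L1 = 0 := g1 (by omega)
    rcases Nat.eq_zero_or_pos m1 with rfl | hm1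
    · obtain rfl : R1 = 0 := g2 rfl
      obtain rfl : L0 = R0 := by simpa using g5
      rcases Nat.eq_zero_or_pos m with rfl | hm0
      · simp [RowRelation, stripRow, variableRow_zero]
      · have a : m ≠ 0 := by omega
        -- The basic identity behind the theorem appears here: x ^ m * (2 + β * x) = 2 * x ^ m + β *
        -- x ^ (m + 1), for a row created by the current variable.
        simp [RowRelation, stripRow, variableRow_zero, a, hm0]
        refine ⟨?_, ?_⟩ <;> ring
    · have a : m1 ≠ 0 := by omega
      have b : m ≠ 0 := by omega
      simp [RowRelation, variableRow_zero', a]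
  have hk' : k1 < k := by omega
  have s1 : stripRow β k k1 k k1 = 2 := by
    simp (disch := omega) only [stripRow, if_neg, if_true]
  have s2 : stripRow β k (k1 - 1) k k1 = 2 := by
    simp (disch := omega) only [stripRow, if_neg, if_true]
  rw [s1, s2, if_neg hk0.ne']
  rcases lt_or_ge m (k - 1) with hmk | hmk
  · simp (disch := omega) only [variableRow_of_lt]
    refine ⟨?_, ?_, ?_, ?_, ?_, ?_, ?_⟩ <;> grind
  rcases Nat.eq_zero_or_pos m with rfl | hm0
  · obtain rfl : k = 1 := by omega
    simp (disch := omega) [variableRow_of_lt, stripRow, RowRelation]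
  have hm' : m1 < m := by omega
  have s3 : stripRow β m m1 m m1 = 2 := by
    simp (disch := omega) only [stripRow, if_neg, if_true]
  have s4 : stripRow β m m1 (m + 1) m1 = β := by
    simp (disch := omega) only [stripRow, if_neg, if_true]
  rw [s3, s4]
  rcases lt_trichotomy m k with hmk' | hmk' | hmk'
  · exact rowRelation_step_below x β hm' hk' (by omega) L0 L1 R0 R1 h
  · exact rowRelation_step_equal x β hm' hk' hmk' L0 L1 R0 R1 h
  · exact rowRelation_step_above x β hm' hk' hmk' L0 L1 R0 R1 h

end RowWeights

/-! ### Strict partitions as sequences, and sums over them. -/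

namespace StrictPartition

/-- Sequences that decrease strictly until they reach `0`. -/
def IsStrictSeq (p : ℕ → ℕ) : Prop := ∀ i, p (i + 1) ≤ p i - 1

theorem part_eq_zero_iff (lam : StrictPartition) (i : ℕ) :
    lam.part i = 0 ↔ lam.length ≤ i := by
  constructor
  · intro h
    by_contra hi
    have hi' : i < lam.parts.length := not_le.mp hi
    have h1 := lam.pos _ (List.getElem_mem hi')
    rw [part, List.getD_eq_getElem _ _ hi'] at h
    omega
  · exact fun h => List.getD_eq_default _ _ h

theorem isStrictSeq_part (lam : StrictPartition) : IsStrictSeq lam.part := by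
  intro i
  by_cases h : i + 1 < lam.parts.length
  · have h1 := List.pairwise_iff_getElem.mp lam.strictAnti i (i + 1) (by omega) h (by omega)
    rw [part, part, List.getD_eq_getElem _ _ h, List.getD_eq_getElem _ _ (by omega)]
    omega
  · rw [(lam.part_eq_zero_iff (i + 1)).mpr (not_lt.mp h)]
    omega

theorem ext_part {lam mu : StrictPartition} (h : ∀ i, lam.part i = mu.part i) : lam = mu := by
  have hl : lam.length = mu.length := by
    refine le_antisymm ?_ ?_
    · rw [← lam.part_eq_zero_iff, h, mu.part_eq_zero_iff]
    · rw [← mu.part_eq_zero_iff, ← h, lam.part_eq_zero_iff]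
  ext1
  refine List.ext_getElem hl fun i h1 h2 => ?_
  have := h i
  rwa [part, part, List.getD_eq_getElem _ _ h1, List.getD_eq_getElem _ _ h2] at this

theorem IsStrictSeq.anti {p : ℕ → ℕ} (hp : IsStrictSeq p) {i j : ℕ} (h : i ≤ j) :
    p j + (j - i) ≤ p i ∨ p j = 0 := by
  induction j, h using Nat.le_induction with
  | base => left; omega
  | succ j hj ih => have := hp j; omega

theorem exists_of_isStrictSeq {p : ℕ → ℕ} (hp : IsStrictSeq p) {n : ℕ} (hn : p n = 0) :
    ∃ lam : StrictPartition, lam.part = p := by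
  induction n generalizing p with
  | zero =>
    refine ⟨⟨[], List.Pairwise.nil, by simp⟩, ?_⟩
    funext i
    have := hp.anti (Nat.zero_le i)
    simp only [part, List.getD_nil]
    omega
  | succ n ih =>
    by_cases h0 : p 0 = 0
    · refine ⟨⟨[], List.Pairwise.nil, by simp⟩, ?_⟩
      funext i
      have := hp.anti (Nat.zero_le i)
      simp only [part, List.getD_nil]
      omega
    obtain ⟨lam, hlam⟩ := ih (p := fun i => p (i + 1)) (fun i => hp (i + 1)) hn
    have key : ∀ a ∈ lam.parts, a < p 0 := by
      intro a ha
      obtain ⟨i, hi, rfl⟩ := List.getElem_of_mem ha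
      have h1 : lam.part i = p (i + 1) := congrFun hlam i
      rw [part, List.getD_eq_getElem _ _ hi] at h1
      have := hp.anti (Nat.zero_le (i + 1))
      omega
    refine ⟨⟨p 0 :: lam.parts, List.pairwise_cons.mpr ⟨key, lam.strictAnti⟩, ?_⟩, ?_⟩
    · intro a ha
      rcases List.mem_cons.mp ha with rfl | ha
      · omega
      · exact lam.pos a ha
    · funext i
      cases i with
      | zero => simp [part]
      | succ i => simpa [part] using congrFun hlam i

/-- A finite sequence of bounded numbers, extended by `0`. -/
def extend {n B : ℕ} (f : Fin n → Fin (B + 1)) (i : ℕ) : ℕ :=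
  if h : i < n then (f ⟨i, h⟩ : ℕ) else 0

theorem extend_of_lt {n B : ℕ} (f : Fin n → Fin (B + 1)) (i : Fin n) : extend f i = f i := by
  simp [extend]

theorem extend_of_ge {n B : ℕ} (f : Fin n → Fin (B + 1)) {i : ℕ} (h : n ≤ i) :
    extend f i = 0 := by
  simp [extend, not_lt.mpr h]

theorem finite_box (n B : ℕ) :
    {lam : StrictPartition | lam.part n = 0 ∧ lam.part 0 ≤ B}.Finite := by
  refine Set.Finite.of_finite_image (f := fun lam (i : Fin n) => Fin.ofNat (B + 1) (lam.part i))
    (Set.toFinite _) ?_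
  rintro lam ⟨h1, h2⟩ mu ⟨h3, h4⟩ h
  refine ext_part fun i => ?_
  have a1 := lam.isStrictSeq_part.anti (Nat.zero_le i)
  have a2 := mu.isStrictSeq_part.anti (Nat.zero_le i)
  rcases lt_or_ge i n with hi | hi
  · have h5 := congrArg Fin.val (congrFun h ⟨i, hi⟩)
    simp only [Fin.val_ofNat] at h5
    rwa [Nat.mod_eq_of_lt (by omega), Nat.mod_eq_of_lt (by omega)] at h5
  · have a3 := lam.isStrictSeq_part.anti hi
    have a4 := mu.isStrictSeq_part.anti hi
    omega

/-- The strict partitions with at most `n` parts, all at most `B`. -/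
noncomputable def box (n B : ℕ) : Finset StrictPartition := (finite_box n B).toFinset

theorem mem_box {n B : ℕ} {lam : StrictPartition} :
    lam ∈ box n B ↔ lam.part n = 0 ∧ lam.part 0 ≤ B := by
  simp [box]

theorem part_le_of_mem_box {n B : ℕ} {lam : StrictPartition} (h : lam ∈ box n B) (i : ℕ) :
    lam.part i ≤ B := by
  have := lam.isStrictSeq_part.anti (Nat.zero_le i)
  have := (mem_box.mp h).2
  omega

theorem part_eq_zero_of_mem_box {n B : ℕ} {lam : StrictPartition} (h : lam ∈ box n B) {i : ℕ}
    (hi : n ≤ i) : lam.part i = 0 := by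
  have := lam.isStrictSeq_part.anti hi
  have := (mem_box.mp h).1
  omega

section Sums

variable {R : Type*} [CommRing R]

/-- If the summand vanishes on sequences that are not strict, the strictness constraint can be
dropped and the sum runs over all bounded functions. -/
theorem sum_box {n B : ℕ} (G : (ℕ → ℕ) → R)
    (hG : ∀ f : Fin n → Fin (B + 1), G (extend f) ≠ 0 → IsStrictSeq (extend f)) :
    ∑ lam ∈ box n B, G lam.part = ∑ f : Fin n → Fin (B + 1), G (extend f) := by
  have key : ∀ lam ∈ box n B,
      extend (fun i : Fin n => Fin.ofNat (B + 1) (lam.part i)) = lam.part := by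
    intro lam hlam
    funext i
    rcases lt_or_ge i n with hi | hi
    · rw [extend, dif_pos hi, Fin.val_ofNat, Nat.mod_eq_of_lt]
      exact Nat.lt_succ_of_le (part_le_of_mem_box hlam i)
    · rw [extend_of_ge _ hi, part_eq_zero_of_mem_box hlam hi]
  refine Finset.sum_of_injOn (fun lam (i : Fin n) => Fin.ofNat (B + 1) (lam.part i))
    ?_ (fun _ _ => Finset.mem_coe.mpr (Finset.mem_univ _)) ?_ ?_
  · intro lam h1 mu h2 h
    refine ext_part fun i => ?_
    rw [← key lam h1, ← key mu h2]
    exact congrFun (congrArg extend h) i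
  · intro f _ hf
    by_contra h0
    obtain ⟨lam, hlam⟩ := exists_of_isStrictSeq (hG f h0) (extend_of_ge f le_rfl)
    refine hf ⟨lam, ?_, ?_⟩
    · rw [Finset.mem_coe, mem_box, hlam]
      refine ⟨extend_of_ge f le_rfl, ?_⟩
      unfold extend
      split_ifs
      · exact Nat.le_of_lt_succ (Fin.is_lt _)
      · omega
    · funext i
      ext
      simp only [hlam, extend_of_lt, Fin.val_ofNat]
      exact Nat.mod_eq_of_lt (Fin.is_lt _)
  · intro lam hlam
    rw [key lam hlam]

theorem sum_box_prod {n B : ℕ} (φ : ℕ → ℕ → R)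
    (hφ : ∀ f : ℕ → ℕ, (∀ i, n ≤ i → f i = 0) → (∀ i < n, φ i (f i) ≠ 0) → IsStrictSeq f) :
    ∑ lam ∈ box n B, ∏ i ∈ Finset.range n, φ i (lam.part i) =
      ∏ i ∈ Finset.range n, ∑ r ∈ Finset.range (B + 1), φ i r := by
  rw [sum_box (fun p => ∏ i ∈ Finset.range n, φ i (p i))]
  · simp only [Finset.prod_range, Finset.sum_range, extend_of_lt]
    rw [Finset.prod_univ_sum, Fintype.piFinset_univ]
  · intro f hf
    refine hφ _ (fun i hi => extend_of_ge f hi) fun i hi h0 => hf ?_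
    exact Finset.prod_eq_zero (Finset.mem_range.mpr hi) h0

/-- The sum over `f 1, …, f n` of the products `∏ w i (f i) (f (i + 1))` for `f 0 = v`, where
`f n = 0`. -/
def chainSum (B : ℕ) : ℕ → (ℕ → ℕ → ℕ → R) → ℕ → R
  | 0, _, v => if v = 0 then 1 else 0
  | n + 1, w, v => ∑ u ∈ Finset.range (B + 1), w 0 v u * chainSum B n (fun i => w (i + 1)) u

/-- Split off the first value and absorb its factor into `g`; keeping `g` arbitrary is what makes
the induction close. -/
theorem sum_prod_eq_chainSum (B n : ℕ) (w : ℕ → ℕ → ℕ → R) (g : ℕ → R) :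
    ∑ f : Fin n → Fin (B + 1),
        g (extend f 0) * ∏ i ∈ Finset.range n, w i (extend f i) (extend f (i + 1)) =
      ∑ v ∈ Finset.range (B + 1), g v * chainSum B n w v := by
  induction n generalizing w g with
  | zero => simp [extend, chainSum]
  | succ n ih =>
    rw [← (Fin.consEquiv fun _ => Fin (B + 1)).sum_comp, Fintype.sum_prod_type,
      Finset.sum_range]
    refine Finset.sum_congr rfl fun v _ => ?_
    have h0 : ∀ f : Fin n → Fin (B + 1), extend (Fin.cons v f : Fin (n + 1) → _) 0 = v := by
      intro f; simp [extend]
    have h1 : ∀ (f : Fin n → Fin (B + 1)) (i : ℕ),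
        extend (Fin.cons v f : Fin (n + 1) → _) (i + 1) = extend f i := by
      intro f i
      unfold extend
      by_cases h : i < n
      · rw [dif_pos h, dif_pos (by omega)]
        exact congrArg Fin.val (Fin.cons_succ (α := fun _ => Fin (B + 1)) v f ⟨i, h⟩)
      · rw [dif_neg h, dif_neg (by omega)]
    have hc : ∀ f : Fin n → Fin (B + 1), Fin.consEquiv (fun _ => Fin (B + 1)) (v, f) =
      (Fin.cons v f : Fin (n + 1) → _) := fun _ => rfl
    simp only [hc, chainSum, Finset.prod_range_succ', h0, h1]
    rw [← Finset.mul_sum]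
    congr 1
    rw [← ih (fun i => w (i + 1)) (w 0 v)]
    refine Finset.sum_congr rfl fun f _ => ?_
    rw [mul_comm]

theorem sum_range_eq_of_support {B : ℕ} (f : ℕ → R) {a : ℕ} (ha : a + 1 ≤ B)
    (hf : ∀ v, v ≠ a → v ≠ a + 1 → f v = 0) :
    ∑ v ∈ Finset.range (B + 1), f v = f a + f (a + 1) := by
  rw [← Finset.sum_pair (show a ≠ a + 1 by omega)]
  symm
  apply Finset.sum_subset
  · intro v hv
    simp only [Finset.mem_insert, Finset.mem_singleton] at hv
    rw [Finset.mem_range]; omega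
  · intro v _ hv
    simp only [Finset.mem_insert, Finset.mem_singleton, not_or] at hv
    exact hf v hv.1 hv.2

theorem sum_range_eq_of_support' {B : ℕ} (f : ℕ → R) {a : ℕ} (ha : a ≤ B)
    (hf : ∀ v, v ≠ a → v + 1 ≠ a → f v = 0) :
    ∑ v ∈ Finset.range (B + 1), f v = f a + if a = 0 then 0 else f (a - 1) := by
  rcases a with _ | a
  · rw [if_pos rfl, add_zero]
    refine Finset.sum_eq_single 0 (fun v _ hv => hf v hv (by omega)) ?_
    intro h; exact absurd (Finset.mem_range.mpr (by omega)) h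
  · rw [if_neg (by omega), add_comm (f _), Nat.add_sub_cancel]
    exact sum_range_eq_of_support f ha fun v h1 h2 => hf v h2 (by omega)

end Sums

/-! ### The intertwining relation. -/

section Intertwining

variable {R : Type*} [CommRing R] (x β : R)

theorem stripRow_eq_zero_of_ne {m m1 l l1 : ℕ} (h : l ≠ m) (h' : l ≠ m + 1) :
    stripRow β m m1 l l1 = 0 := by
  unfold stripRow
  split_ifs <;> first | rfl | omega

theorem stripRow_zero_eq_zero {m m1 l l1 : ℕ} (h : m = 0) (h' : l ≠ 0) :
    stripRow β m m1 l l1 = 0 := by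
  simp [stripRow, h, h']

/-- Induction on the number of rows, removing the top one. The two support statements reduce each
sum over the next row to two terms, after which `rowRelation_step` applies. -/
theorem chain_relation {n B : ℕ}
    {mu ka : ℕ → ℕ} (hmu : IsStrictSeq mu) (hka : IsStrictSeq ka) (hmun : mu n = 0)
    (hkan : ka n = 0) (hmuB : mu 0 + 1 ≤ B) (hkaB : ka 0 ≤ B) (L K : ℕ → R)
    (hL : L = chainSum B n fun i v u =>
      variableRow x β true (mu i) (mu (i + 1)) v u * stripRow β v u (ka i) (ka (i + 1)))
    (hK : K = chainSum B n fun i v u =>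
      stripRow β (mu i) (mu (i + 1)) v u * variableRow x β false v u (ka i) (ka (i + 1))) :
    (∀ v, v ≠ ka 0 → v + 1 ≠ ka 0 → L v = 0) ∧ (∀ v, v ≠ mu 0 → v ≠ mu 0 + 1 → K v = 0) ∧
    RowRelation x β (mu 0) (ka 0) (L (ka 0)) (if ka 0 = 0 then 0 else L (ka 0 - 1))
      (K (mu 0)) (K (mu 0 + 1)) := by
  induction n generalizing mu ka L K with
  | zero =>
    subst hL hK
    refine ⟨?_, ?_, ?_⟩
    · intro v hv _
      rw [hkan] at hv
      simp [chainSum, hv]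
    · intro v hv _
      rw [hmun] at hv
      simp [chainSum, hv]
    · simp [RowRelation, chainSum, hmun, hkan]
  | succ n ih =>
    have m0 := hmu 0
    have k0 := hka 0
    simp only [zero_add] at m0 k0
    obtain ⟨a1, a2, a3⟩ := ih (mu := fun i => mu (i + 1)) (ka := fun i => ka (i + 1))
      (fun i => hmu (i + 1)) (fun i => hka (i + 1)) hmun hkan
      (by simp only [zero_add]; omega) (by simp only [zero_add]; omega) _ _ rfl rfl
    simp only [zero_add] at a1 a2 a3
    set L' := chainSum B n fun i v u => variableRow x β true (mu (i + 1)) (mu (i + 1 + 1)) v u *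
      stripRow β v u (ka (i + 1)) (ka (i + 1 + 1)) with hL'
    set K' := chainSum B n fun i v u => stripRow β (mu (i + 1)) (mu (i + 1 + 1)) v u *
      variableRow x β false v u (ka (i + 1)) (ka (i + 1 + 1)) with hK'
    have eL : ∀ v, L v = variableRow x β true (mu 0) (mu 1) v (ka 1) *
        stripRow β v (ka 1) (ka 0) (ka 1) * L' (ka 1) +
        variableRow x β true (mu 0) (mu 1) v (ka 1 - 1) *
        stripRow β v (ka 1 - 1) (ka 0) (ka 1) * (if ka 1 = 0 then 0 else L' (ka 1 - 1)) := by
      intro v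
      rw [hL, chainSum, sum_range_eq_of_support' (a := ka 1) _ (by omega)]
      · simp only [zero_add]
        split_ifs
        · simp only [mul_zero]; rfl
        · rfl
      · intro u hu hu'
        exact mul_eq_zero_of_right _ (a1 u hu hu')
    have eK : ∀ v, K v = stripRow β (mu 0) (mu 1) v (mu 1) *
        variableRow x β false v (mu 1) (ka 0) (ka 1) * K' (mu 1) +
        stripRow β (mu 0) (mu 1) v (mu 1 + 1) *
        variableRow x β false v (mu 1 + 1) (ka 0) (ka 1) * K' (mu 1 + 1) := by
      intro v
      rw [hK, chainSum, sum_range_eq_of_support (a := mu 1) _ (by omega)]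
      intro u hu hu'
      exact mul_eq_zero_of_right _ (a2 u hu hu')
    refine ⟨?_, ?_, ?_⟩
    · intro v h h'
      rw [eL, stripRow_eq_zero_of_ne β h.symm (Ne.symm h'),
        stripRow_eq_zero_of_ne β h.symm (Ne.symm h')]
      ring
    · intro v h h'
      rw [eK, stripRow_eq_zero_of_ne β h h', stripRow_eq_zero_of_ne β h h']
      ring
    · simp only [eL, eK]
      exact rowRelation_step x β m0 k0 _ _ _ _ a3

/-- Adding a variable commutes with passing from `GP` to `GQ`. -/
theorem intertwining {n B : ℕ}
    {mu ka : StrictPartition} (hmu : mu ∈ box n B) (hka : ka ∈ box n (B + 1)) :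
    ∑ nu ∈ box n (B + 1), (∏ i ∈ Finset.range n,
        variableRow x β true (mu.part i) (mu.part (i + 1)) (nu.part i) (nu.part (i + 1))) *
        (∏ i ∈ Finset.range n,
          stripRow β (nu.part i) (nu.part (i + 1)) (ka.part i) (ka.part (i + 1))) =
    ∑ lam ∈ box n (B + 1), (∏ i ∈ Finset.range n,
          stripRow β (mu.part i) (mu.part (i + 1)) (lam.part i) (lam.part (i + 1))) *
        ∏ i ∈ Finset.range n,
        variableRow x β false (lam.part i) (lam.part (i + 1)) (ka.part i) (ka.part (i + 1)) := by
  obtain ⟨a1, a2, a3⟩ := chain_relation x β mu.isStrictSeq_part ka.isStrictSeq_part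
    (mem_box.mp hmu).1 (mem_box.mp hka).1 (Nat.succ_le_succ (mem_box.mp hmu).2)
    (mem_box.mp hka).2 _ _ rfl rfl
  have e := a3.2.2.2.2.1
  simp only [← Finset.prod_mul_distrib]
  rw [sum_box (fun p => ∏ i ∈ Finset.range n,
        (variableRow x β true (mu.part i) (mu.part (i + 1)) (p i) (p (i + 1)) *
          stripRow β (p i) (p (i + 1)) (ka.part i) (ka.part (i + 1)))),
    sum_box (fun p => ∏ i ∈ Finset.range n,
        (stripRow β (mu.part i) (mu.part (i + 1)) (p i) (p (i + 1)) *
          variableRow x β false (p i) (p (i + 1)) (ka.part i) (ka.part (i + 1))))]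
  · have b1 := sum_prod_eq_chainSum (B + 1) n (fun i v u =>
      variableRow x β true (mu.part i) (mu.part (i + 1)) v u *
        stripRow β v u (ka.part i) (ka.part (i + 1))) (fun _ => 1)
    have b2 := sum_prod_eq_chainSum (B + 1) n (fun i v u =>
      stripRow β (mu.part i) (mu.part (i + 1)) v u *
        variableRow x β false v u (ka.part i) (ka.part (i + 1))) (fun _ => 1)
    simp only [one_mul] at b1 b2
    rw [b1, b2, sum_range_eq_of_support' _ (mem_box.mp hka).2 a1,
      sum_range_eq_of_support _ (Nat.succ_le_succ (mem_box.mp hmu).2) a2, e]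
  · intro f hf i
    have hne : ∀ j < n, stripRow β (mu.part j) (mu.part (j + 1)) (extend f j)
        (extend f (j + 1)) ≠ 0 := fun j hj h0 =>
      hf (Finset.prod_eq_zero (Finset.mem_range.mpr hj) (by rw [h0, zero_mul]))
    rcases lt_or_ge i n with hi | hi
    swap
    · rw [extend_of_ge f (show n ≤ i + 1 by omega)]; omega
    rcases Nat.lt_or_ge (i + 1) n with hi' | hi'
    swap
    · rw [extend_of_ge f hi']; omega
    have c1 := hne i hi
    have c2 := hne (i + 1) hi'
    have c3 := mu.isStrictSeq_part i
    generalize mu.part i = a at *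
    generalize mu.part (i + 1) = b at *
    generalize extend f i = c at *
    generalize extend f (i + 1) = d at *
    have d1 : ¬ (a = 0 ∧ c ≠ 0) := fun h => c1 (stripRow_zero_eq_zero β h.1 h.2)
    have d2 : ¬ (b = 0 ∧ d ≠ 0) := fun h => c2 (stripRow_zero_eq_zero β h.1 h.2)
    have d3 : ¬ (c ≠ a ∧ c ≠ a + 1) := fun h => c1 (stripRow_eq_zero_of_ne β h.1 h.2)
    have d4 : ¬ (d ≠ b ∧ d ≠ b + 1) := fun h => c2 (stripRow_eq_zero_of_ne β h.1 h.2)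
    -- Strictness of `lam` needs this branch of `stripRow`: if the next row gains a box directly
    -- below the end of this row, this row must gain one too.
    have d5 : ¬ (a ≠ 0 ∧ b < a ∧ (d = b + 1 ∧ a = b + 1) ∧ c ≠ a + 1) := by
      rintro ⟨q1, q2, q3, q4⟩
      exact c1 (by rw [stripRow, if_neg q1, if_neg (not_le.mpr q2), if_pos q3, if_neg q4])
    omega
  · intro f hf i
    have hne : ∀ j < n, stripRow β (extend f j)
        (extend f (j + 1)) (ka.part j) (ka.part (j + 1)) ≠ 0 := fun j hj h0 =>
      hf (Finset.prod_eq_zero (Finset.mem_range.mpr hj) (by rw [h0, mul_zero]))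
    rcases lt_or_ge i n with hi | hi
    swap
    · rw [extend_of_ge f (show n ≤ i + 1 by omega)]; omega
    rcases Nat.lt_or_ge (i + 1) n with hi' | hi'
    swap
    · rw [extend_of_ge f hi']; omega
    have c1 := hne i hi
    have c2 := hne (i + 1) hi'
    have c3 := ka.isStrictSeq_part i
    generalize ka.part i = a at *
    generalize ka.part (i + 1) = b at *
    generalize extend f i = c at *
    generalize extend f (i + 1) = d at *
    have d1 : ¬ (c = 0 ∧ a ≠ 0) := fun h => c1 (stripRow_zero_eq_zero β h.1 h.2)
    have d4 : ¬ (b ≠ d ∧ b ≠ d + 1) := fun h => c2 (stripRow_eq_zero_of_ne β h.1 h.2)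
    -- Strictness of `nu` comes from the value 0 of `stripRow` at `m ≤ m1`.
    have d5 : ¬ (c ≠ 0 ∧ c ≤ d) := by
      rintro ⟨q1, q2⟩
      exact c1 (by rw [stripRow, if_neg q1, if_pos q2])
    omega

end Intertwining

end StrictPartition

/-! ### Shifted diagrams and the layers of a letter. -/

namespace StrictPartition

theorem part_anti (lam : StrictPartition) {i j : ℕ} (h : i ≤ j) :
    lam.part j + (j - i) ≤ lam.part i ∨ lam.part j = 0 :=
  lam.isStrictSeq_part.anti h

theorem diagram_subset_iff {mu lam : StrictPartition} :
    mu.diagram ⊆ lam.diagram ↔ ∀ i, mu.part i ≤ lam.part i := by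
  constructor
  · intro h i
    by_contra hi
    have h1 : (i, i + lam.part i) ∈ mu.diagram := by rw [mem_diagram]; omega
    have h2 := h h1
    rw [mem_diagram] at h2
    omega
  · rintro h ⟨i, j⟩ hij
    rw [mem_diagram] at hij ⊢
    have := h i
    omega

theorem diagram_injective : Function.Injective diagram := fun _ _ h =>
  ext_part fun i => le_antisymm (diagram_subset_iff.mp h.le i) (diagram_subset_iff.mp h.ge i)

theorem card_diagram_eq_sum {lam : StrictPartition} {n : ℕ} (h : lam.part n = 0) :
    lam.diagram.card = ∑ i ∈ Finset.range n, lam.part i := by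
  rw [diagram, Finset.card_biUnion]
  · have hn := (lam.part_eq_zero_iff n).mp h
    rw [← Finset.sum_subset (Finset.range_mono hn)]
    · refine Finset.sum_congr rfl fun i _ => ?_
      rw [Finset.card_image_of_injective _ (Prod.mk_right_injective i), Nat.card_Ico]
      omega
    · intro i _ hi
      exact (lam.part_eq_zero_iff i).mpr (by simpa using hi)
  · intro i _ j _ hij
    rw [Function.onFun, Finset.disjoint_left]
    intro p hp hp'
    simp only [Finset.mem_image] at hp hp'
    obtain ⟨_, _, rfl⟩ := hp
    obtain ⟨_, _, h⟩ := hp'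
    exact hij (Prod.ext_iff.mp h).1.symm

/-- The rightmost box gives the length of each row. Closure along rows leaves no gaps; closure up
columns makes the lengths drop strictly, since a box is counted one step further from the diagonal
in the row above. -/
theorem exists_diagram_eq (D : Finset (ℕ × ℕ)) (h0 : ∀ i j, (i, j) ∈ D → i ≤ j)
    (h1 : ∀ i j k, (i, j) ∈ D → i ≤ k → k < j → (i, k) ∈ D)
    (h2 : ∀ i j, (i + 1, j) ∈ D → (i, j) ∈ D) :
    ∃ nu : StrictPartition, nu.diagram = D := by
  let p : ℕ → ℕ := fun i => (D.filter fun q => q.1 = i).sup fun q => q.2 + 1 - i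
  have hp : ∀ i j, (i, j) ∈ D ↔ i ≤ j ∧ j < i + p i := by
    intro i j
    constructor
    · intro h
      have := h0 i j h
      have h3 : j + 1 - i ≤ p i :=
        Finset.le_sup (f := fun q : ℕ × ℕ => q.2 + 1 - i)
          (Finset.mem_filter.mpr ⟨h, rfl⟩ : (i, j) ∈ D.filter fun q => q.1 = i)
      omega
    · rintro ⟨h3, h4⟩
      have h5 : j - i < p i := by omega
      obtain ⟨⟨a, b⟩, hq, h6⟩ := Finset.lt_sup_iff.mp h5
      obtain ⟨hD, hqi⟩ := Finset.mem_filter.mp hq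
      obtain rfl : a = i := hqi
      dsimp only at h6
      rcases (show j = b ∨ j < b by omega) with rfl | h7
      · exact hD
      · exact h1 _ _ _ hD h3 h7
  have hs : IsStrictSeq p := by
    intro i
    refine Finset.sup_le fun q hq => ?_
    obtain ⟨hq, h3⟩ := Finset.mem_filter.mp hq
    have h4 := (hp i q.2).mp (h2 i q.2 (by rw [← h3]; exact hq))
    omega
  have hn : p (D.sup Prod.fst + 1) = 0 := by
    refine Nat.eq_zero_of_not_pos fun h => ?_
    have h3 := (hp (D.sup Prod.fst + 1) (D.sup Prod.fst + 1)).mpr ⟨le_rfl, by omega⟩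
    have h4 : D.sup Prod.fst + 1 ≤ D.sup Prod.fst := Finset.le_sup (f := Prod.fst) h3
    omega
  obtain ⟨nu, hnu⟩ := exists_of_isStrictSeq hs hn
  refine ⟨nu, ?_⟩
  ext ⟨i, j⟩
  rw [mem_diagram, hp, hnu]

/-- The condition on row `i` for the following situation: a tableau of shape `lam` with entries at
most `m` restricts to a tableau of shape `nu` with entries less than `m`, and the boxes that do not
contain `m` form the diagram of `ka`. Here `l, l1, n, n1, k` stand for `lam_i`, `lam_(i+1)`, `nu_i`,
`nu_(i+1)`, `ka_i`. Primed entries are allowed on the diagonal when `d` is true. -/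
def LayerRow (d : Bool) (m l l1 n n1 k : ℕ) : Prop :=
  k ≤ n ∧ n ≤ l ∧ (k = n ∨ k + 1 = n ∧ (n1 < k ∨ k = 0)) ∧
    (Even m → l ≤ k + 1 ∧ (d = false → k = 0 → l = 0)) ∧ (¬ Even m → l1 < k ∨ l1 = 0)

/-- The condition `LayerRow` for all rows. -/
def IsLayer (d : Bool) (m : ℕ) (lam nu ka : StrictPartition) : Prop :=
  ∀ i, LayerRow d m (lam.part i) (lam.part (i + 1)) (nu.part i) (nu.part (i + 1)) (ka.part i)

end StrictPartition

/-! ### Adding and removing the largest letter. -/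

namespace SetShYT

open StrictPartition

variable {lam nu ka : StrictPartition} {d : Bool} {m : ℕ}

theorem mem_diagram_of_mem (T : SetShYT lam) {i j a : ℕ} (h : a ∈ T.entry i j) :
    (i, j) ∈ lam.diagram := (T.nonempty_iff i j).mp ⟨a, h⟩

theorem mem_ite_singleton {p : Prop} [Decidable p] {a b : ℕ} :
    a ∈ (if p then {b} else ∅ : Finset ℕ) ↔ p ∧ a = b := by
  split_ifs with h <;> simp [h]

/-- The tableau obtained by adding the entry `m` to the boxes in `lam / ka`. -/
def addLayer (T : SetShYT nu) (hT : ∀ i j, ∀ a ∈ T.entry i j, a < m)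
    (h : IsLayer d m lam nu ka) : SetShYT lam where
  entry i j := T.entry i j ∪ if (i, j) ∈ skewDiagram lam ka then {m} else ∅
  nonempty_iff i j := by
    have hi := h i
    have h1 := T.nonempty_iff i j
    simp only [LayerRow, skewDiagram, Finset.mem_sdiff, mem_diagram] at *
    rw [Finset.union_nonempty, h1]
    split_ifs <;> simp <;> omega
  row_weak i j₁ j₂ hj a ha b hb := by
    have hi := h i
    have h1 := fun h => mem_diagram_of_mem T (i := i) (j := j₂) (a := b) h
    have h2 := hT i j₁ a
    simp only [LayerRow, skewDiagram, Finset.mem_sdiff, mem_diagram, Finset.mem_union,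
      mem_ite_singleton] at *
    rcases ha with ha | ⟨ha, rfl⟩ <;> rcases hb with hb | ⟨hb, rfl⟩
    · exact T.row_weak i j₁ j₂ hj a ha b hb
    · exact (h2 ha).le
    · have := h1 hb
      omega
    · rfl
  col_weak i₁ i₂ j hj a ha b hb := by
    have hi := h i₁
    have h1 := fun h => mem_diagram_of_mem T (i := i₂) (j := j) (a := b) h
    have h2 := hT i₁ j a
    have h3 := nu.part_anti (Nat.succ_le_of_lt hj)
    have h4 := nu.part_anti (Nat.le_succ i₁)
    simp only [LayerRow, skewDiagram, Finset.mem_sdiff, mem_diagram, Finset.mem_union,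
      mem_ite_singleton, Nat.succ_eq_add_one] at *
    rcases ha with ha | ⟨ha, rfl⟩ <;> rcases hb with hb | ⟨hb, rfl⟩
    · exact T.col_weak i₁ i₂ j hj a ha b hb
    · exact (h2 ha).le
    · have := h1 hb
      omega
    · rfl
  col_unprimed i₁ i₂ j a ha h1 h2 := by
    have key : ∀ i i' : ℕ, i < i' → ¬ Even m → (i, j) ∈ skewDiagram lam ka →
        (i', j) ∈ skewDiagram lam ka → False := by
      intro i i' hi hm q q'
      have h3 := lam.part_anti (Nat.succ_le_of_lt hi)
      have h4 := (h i).2.2.2.2 hm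
      simp only [skewDiagram, Finset.mem_sdiff, mem_diagram, Nat.succ_eq_add_one] at *
      omega
    simp only [Finset.mem_union, mem_ite_singleton] at h1 h2
    rcases h1 with h1 | ⟨h1, rfl⟩ <;> rcases h2 with h2 | ⟨h2, h2'⟩
    · exact T.col_unprimed i₁ i₂ j a ha h1 h2
    · exact absurd (hT _ _ _ h1) (by omega)
    · exact absurd (hT _ _ _ h2) (lt_irrefl _)
    · rcases lt_trichotomy i₁ i₂ with hi | hi | hi
      · exact (key _ _ hi ha h1 h2).elim
      · exact hi
      · exact (key _ _ hi ha h2 h1).elim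
  row_primed i j₁ j₂ a ha h1 h2 := by
    simp only [Finset.mem_union, mem_ite_singleton] at h1 h2
    rcases h1 with h1 | ⟨h1, rfl⟩ <;> rcases h2 with h2 | ⟨h2, h2'⟩
    · exact T.row_primed i j₁ j₂ a ha h1 h2
    · exact absurd (hT _ _ _ h1) (by omega)
    · exact absurd (hT _ _ _ h2) (lt_irrefl _)
    · have := (h i).2.2.2.1 ha
      simp only [skewDiagram, Finset.mem_sdiff, mem_diagram] at *
      omega

theorem mem_entry_addLayer (T : SetShYT nu) (hT : ∀ i j, ∀ a ∈ T.entry i j, a < m)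
    (h : IsLayer d m lam nu ka) {i j a : ℕ} :
    a ∈ (T.addLayer hT h).entry i j ↔
      a ∈ T.entry i j ∨ ((i, j) ∈ skewDiagram lam ka ∧ a = m) := by
  simp only [addLayer, Finset.mem_union, mem_ite_singleton]

theorem isP_addLayer (T : SetShYT nu) (hT : ∀ i j, ∀ a ∈ T.entry i j, a < m)
    (h : IsLayer false m lam nu ka) (hP : T.IsP) : (T.addLayer hT h).IsP := by
  intro i a ha
  rcases (mem_entry_addLayer T hT h).mp ha with ha | ⟨ha, rfl⟩
  · exact hP i a ha
  · intro hm
    have := ((h i).2.2.2.1 hm).2 rfl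
    simp only [skewDiagram, Finset.mem_sdiff, mem_diagram] at *
    omega

/-- Take for `nu` the boxes with an entry below `m`, and for `ka` the boxes without `m`. Both are
shifted diagrams because `m` is the largest possible entry and `T` increases weakly. -/
theorem exists_addLayer (T : SetShYT lam) (hT : ∀ i j, ∀ a ∈ T.entry i j, a < m + 1)
    (hP : d = false → T.IsP) :
    ∃ (nu ka : StrictPartition) (h : IsLayer d m lam nu ka) (U : SetShYT nu)
      (hU : ∀ i j, ∀ a ∈ U.entry i j, a < m), (d = false → U.IsP) ∧ U.addLayer hU h = T := by
  have hlam := fun i => lam.isStrictSeq_part i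
  obtain ⟨nu, hnu⟩ := exists_diagram_eq
    (lam.diagram.filter fun q => ∃ a ∈ T.entry q.1 q.2, a < m)
    (by
      intro i j h
      exact ((mem_diagram _ _ _).mp (Finset.mem_filter.mp h).1).1)
    (by
      intro i j k h h1 h2
      obtain ⟨h3, a, ha, ham⟩ := Finset.mem_filter.mp h
      have h4 : (i, k) ∈ lam.diagram := by rw [mem_diagram] at *; omega
      obtain ⟨b, hb⟩ := (T.nonempty_iff i k).mpr h4
      exact Finset.mem_filter.mpr ⟨h4, b, hb, (T.row_weak i k j h2 b hb a ha).trans_lt ham⟩)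
    (by
      intro i j h
      obtain ⟨h3, a, ha, ham⟩ := Finset.mem_filter.mp h
      have h4 : (i, j) ∈ lam.diagram := by
        have := hlam i
        rw [mem_diagram] at *; omega
      obtain ⟨b, hb⟩ := (T.nonempty_iff i j).mpr h4
      exact Finset.mem_filter.mpr
        ⟨h4, b, hb, (T.col_weak i (i + 1) j (by omega) b hb a ha).trans_lt ham⟩)
  obtain ⟨ka, hka⟩ := exists_diagram_eq (lam.diagram.filter fun q => m ∉ T.entry q.1 q.2)
    (by
      intro i j h
      exact ((mem_diagram _ _ _).mp (Finset.mem_filter.mp h).1).1)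
    (by
      intro i j k h h1 h2
      obtain ⟨h3, h5⟩ := Finset.mem_filter.mp h
      have h4 : (i, k) ∈ lam.diagram := by rw [mem_diagram] at *; omega
      refine Finset.mem_filter.mpr ⟨h4, fun hm => h5 ?_⟩
      obtain ⟨b, hb⟩ := (T.nonempty_iff i j).mpr h3
      have h6 := T.row_weak i k j h2 m hm b hb
      have h7 := hT i j b hb
      rwa [show b = m by omega] at hb)
    (by
      intro i j h
      obtain ⟨h3, h5⟩ := Finset.mem_filter.mp h
      have h4 : (i, j) ∈ lam.diagram := by
        have := hlam i
        rw [mem_diagram] at *; omega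
      refine Finset.mem_filter.mpr ⟨h4, fun hm => h5 ?_⟩
      obtain ⟨b, hb⟩ := (T.nonempty_iff (i + 1) j).mpr h3
      have h6 := T.col_weak i (i + 1) j (by omega) m hm b hb
      have h7 := hT (i + 1) j b hb
      rwa [show b = m by omega] at hb)
  have mnu : ∀ i j, (i, j) ∈ nu.diagram ↔ ∃ a ∈ T.entry i j, a < m := by
    intro i j
    rw [hnu, Finset.mem_filter]
    exact ⟨fun h => h.2, fun h => ⟨mem_diagram_of_mem T h.choose_spec.1, h⟩⟩
  have mka : ∀ i j, (i, j) ∈ skewDiagram lam ka ↔ m ∈ T.entry i j := by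
    intro i j
    rw [skewDiagram, Finset.mem_sdiff, hka, Finset.mem_filter]
    have := fun h : m ∈ T.entry i j => mem_diagram_of_mem T h
    tauto
  have kanu : ∀ i, ka.part i ≤ nu.part i := by
    refine diagram_subset_iff.mp ?_
    rintro ⟨i, j⟩ h
    rw [hka, Finset.mem_filter] at h
    obtain ⟨a, ha⟩ := (T.nonempty_iff i j).mpr h.1
    refine (mnu i j).mpr ⟨a, ha, ?_⟩
    have h1 := hT i j a ha
    have h2 : a ≠ m := fun h2 => h.2 (h2 ▸ ha)
    omega
  have nulam : ∀ i, nu.part i ≤ lam.part i := by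
    refine diagram_subset_iff.mp ?_
    rw [hnu]
    exact Finset.filter_subset _ _
  have hm : ∀ i j, i ≤ j → j < i + lam.part i → i + ka.part i ≤ j → m ∈ T.entry i j := by
    intro i j h1 h2 h3
    rw [← mka, skewDiagram, Finset.mem_sdiff, mem_diagram, mem_diagram]
    omega
  have hlt : ∀ i j, i ≤ j → j < i + nu.part i → ∃ a ∈ T.entry i j, a < m := by
    intro i j h1 h2
    rw [← mnu, mem_diagram]
    omega
  have hL : IsLayer d m lam nu ka := by
    intro i
    have k0 := kanu i
    have k1 := nulam i
    have k2 := hlam i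
    have k3 := ka.isStrictSeq_part i
    refine ⟨k0, k1, ?_, ?_, ?_⟩
    -- A box with both `m` and a smaller entry must be a corner of `nu`: otherwise its right or
    -- lower neighbour would have an entry below `m`.
    · by_contra hc
      have b1 := hm i (i + ka.part i) (by omega) (by omega) (by omega)
      by_cases b2 : ka.part i + 1 < nu.part i
      · obtain ⟨b, hb, hbm⟩ := hlt i (i + ka.part i + 1) (by omega) (by omega)
        have := T.row_weak i _ _ (by omega) m b1 b hb
        omega
      · obtain ⟨b, hb, hbm⟩ := hlt (i + 1) (i + ka.part i) (by omega) (by omega)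
        have := T.col_weak i _ _ (by omega) m b1 b hb
        omega
    · intro he
      constructor
      · by_contra hc
        have b1 := hm i (i + ka.part i) (by omega) (by omega) (by omega)
        have b2 := hm i (i + ka.part i + 1) (by omega) (by omega) (by omega)
        have := T.row_primed i _ _ m he b1 b2
        omega
      · intro hd h0
        by_contra hc
        exact hP hd i m (hm i i (by omega) (by omega) (by omega)) he
    · intro he
      by_contra hc
      -- This is the column of the last box of row i + 1; both it and the box above it would contain
      -- the unprimed letter `m`.
      have b1 := hm i (i + lam.part (i + 1)) (by omega) (by omega) (by omega)
      have b2 := hm (i + 1) (i + lam.part (i + 1)) (by omega) (by omega) (by omega)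
      have := T.col_unprimed _ _ _ m he b1 b2
      omega
  refine ⟨nu, ka, hL, ⟨fun i j => (T.entry i j).filter (· < m), ?_, ?_, ?_, ?_, ?_⟩, ?_, ?_, ?_⟩
  · intro i j
    rw [mnu]
    simp [Finset.Nonempty]
  · intro i j₁ j₂ hj a ha b hb
    exact T.row_weak i j₁ j₂ hj a (Finset.mem_filter.mp ha).1 b (Finset.mem_filter.mp hb).1
  · intro i₁ i₂ j hj a ha b hb
    exact T.col_weak i₁ i₂ j hj a (Finset.mem_filter.mp ha).1 b (Finset.mem_filter.mp hb).1
  · intro i₁ i₂ j a ha h1 h2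
    exact T.col_unprimed i₁ i₂ j a ha (Finset.mem_filter.mp h1).1 (Finset.mem_filter.mp h2).1
  · intro i j₁ j₂ a ha h1 h2
    exact T.row_primed i j₁ j₂ a ha (Finset.mem_filter.mp h1).1 (Finset.mem_filter.mp h2).1
  · intro i j a ha
    exact (Finset.mem_filter.mp ha).2
  · intro hd i a ha
    exact hP hd i a (Finset.mem_filter.mp ha).1
  · ext i j a
    rw [mem_entry_addLayer, mka, Finset.mem_filter]
    constructor
    · rintro (h | ⟨h, rfl⟩)
      · exact h.1
      · exact h
    · intro h
      have := hT i j a h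
      by_cases ham : a = m
      · exact Or.inr ⟨ham ▸ h, ham⟩
      · exact Or.inl ⟨h, by omega⟩

theorem sum_diagram_eq_sum_of_subset {M : Type*} [AddCommMonoid M] (T : SetShYT nu)
    (h : nu.diagram ⊆ lam.diagram) (f : ℕ → M) :
    ∑ p ∈ nu.diagram, ∑ a ∈ T.entry p.1 p.2, f a =
      ∑ p ∈ lam.diagram, ∑ a ∈ T.entry p.1 p.2, f a := by
  refine Finset.sum_subset h fun p _ hp => ?_
  have := mt (T.nonempty_iff p.1 p.2).mp hp
  rw [Finset.not_nonempty_iff_eq_empty] at this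
  rw [this, Finset.sum_empty]

theorem sum_addLayer {M : Type*} [AddCommMonoid M] (T : SetShYT nu)
    (hT : ∀ i j, ∀ a ∈ T.entry i j, a < m) (h : IsLayer d m lam nu ka) (f : ℕ → M) :
    ∑ p ∈ lam.diagram, ∑ a ∈ (T.addLayer hT h).entry p.1 p.2, f a =
      ∑ p ∈ nu.diagram, ∑ a ∈ T.entry p.1 p.2, f a +
        (lam.diagram.card - ka.diagram.card) • f m := by
  have h1 : nu.diagram ⊆ lam.diagram := diagram_subset_iff.mpr fun i => (h i).2.1
  have h2 : ka.diagram ⊆ lam.diagram :=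
    diagram_subset_iff.mpr fun i => (h i).1.trans (h i).2.1
  have h3 : ∑ p ∈ lam.diagram \ ka.diagram, f m =
      ∑ p ∈ lam.diagram, if p ∈ lam.diagram \ ka.diagram then f m else 0 := by
    rw [Finset.sum_ite_mem, Finset.inter_eq_right.mpr Finset.sdiff_subset]
  rw [sum_diagram_eq_sum_of_subset T h1, ← Finset.card_sdiff_of_subset h2, ← Finset.sum_const,
    h3, ← Finset.sum_add_distrib]
  refine Finset.sum_congr rfl ?_
  rintro ⟨i, j⟩ _
  have h4 : Disjoint (T.entry i j) (if (i, j) ∈ skewDiagram lam ka then {m} else ∅) := by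
    rw [Finset.disjoint_left]
    intro a ha ha'
    have := hT _ _ a ha
    rw [mem_ite_singleton] at ha'
    omega
  change ∑ a ∈ T.entry i j ∪ (if (i, j) ∈ skewDiagram lam ka then {m} else ∅), f a = _
  rw [Finset.sum_union h4, skewDiagram]
  split_ifs <;> simp

theorem weight_addLayer (T : SetShYT nu) (hT : ∀ i j, ∀ a ∈ T.entry i j, a < m)
    (h : IsLayer d m lam nu ka) : (T.addLayer hT h).weight = T.weight +
      Finsupp.single (varIndex m) (lam.diagram.card - ka.diagram.card) := by
  rw [weight, sum_addLayer, Finsupp.smul_single, smul_eq_mul, mul_one, weight]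

/-- Of the |lam / ka| new entries, |lam / nu| fill new boxes; only the remaining |nu / ka| raise the
power of β. -/
theorem size_addLayer (T : SetShYT nu) (hT : ∀ i j, ∀ a ∈ T.entry i j, a < m)
    (h : IsLayer d m lam nu ka) : (T.addLayer hT h).size - lam.diagram.card =
      (T.size - nu.diagram.card) + (nu.diagram.card - ka.diagram.card) := by
  have h0 := sum_addLayer T hT h (fun _ => 1)
  have h1 : nu.diagram ⊆ lam.diagram := diagram_subset_iff.mpr fun i => (h i).2.1
  have h2 : ka.diagram ⊆ nu.diagram := diagram_subset_iff.mpr fun i => (h i).1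
  have h3 := Finset.card_le_card h1
  have h4 := Finset.card_le_card h2
  have h5 := T.card_diagram_le_size
  simp only [← Finset.card_eq_sum_ones] at h0
  rw [smul_eq_mul, mul_one] at h0
  unfold size at *
  omega

/-- The entries below `m` recover `T`, hence `nu`, and the places of `m` recover `ka`. Entries are
compared as functions because the two tableaux have different types a priori. -/
theorem addLayer_injective {nu' ka' : StrictPartition} {T : SetShYT nu} {T' : SetShYT nu'}
    {hT : ∀ i j, ∀ a ∈ T.entry i j, a < m} {hT' : ∀ i j, ∀ a ∈ T'.entry i j, a < m}
    {h : IsLayer d m lam nu ka} {h' : IsLayer d m lam nu' ka'}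
    (e : T.addLayer hT h = T'.addLayer hT' h') : nu = nu' ∧ ka = ka' ∧ T.entry = T'.entry := by
  have h1 : T.entry = T'.entry := by
    funext i j
    ext a
    have h1 := mem_entry_addLayer T hT h (i := i) (j := j) (a := a)
    rw [e, mem_entry_addLayer] at h1
    have h2 := hT i j a
    have h3 := hT' i j a
    constructor
    · intro q
      rcases h1.mpr (Or.inl q) with q' | q'
      · exact q'
      · have := h2 q
        omega
    · intro q
      rcases h1.mp (Or.inl q) with q' | q'
      · exact q'
      · have := h3 q
        omega
  refine ⟨?_, ?_, h1⟩
  · refine diagram_injective (Finset.ext fun ⟨i, j⟩ => ?_)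
    rw [← T.nonempty_iff, ← T'.nonempty_iff, h1]
  · have h2 : ka.diagram ⊆ lam.diagram :=
      diagram_subset_iff.mpr fun i => (h i).1.trans (h i).2.1
    have h3 : ka'.diagram ⊆ lam.diagram :=
      diagram_subset_iff.mpr fun i => (h' i).1.trans (h' i).2.1
    refine diagram_injective (Finset.ext fun ⟨i, j⟩ => ?_)
    have h4 := mem_entry_addLayer T hT h (i := i) (j := j) (a := m)
    rw [e, mem_entry_addLayer] at h4
    have h5 := hT i j m
    have h6 := hT' i j m
    have h7 := @h2 (i, j)
    have h8 := @h3 (i, j)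
    simp only [skewDiagram, Finset.mem_sdiff, lt_irrefl, and_true] at *
    tauto

end SetShYT

/-! ### Generating functions for finitely many letters. -/

namespace SetShYT

open StrictPartition

variable {lam nu ka : StrictPartition} {d : Bool} {m : ℕ}

/-- The tableaux with all entries less than `m`, without primed diagonal entries if `d` is false. -/
def bounded (d : Bool) (m : ℕ) (lam : StrictPartition) : Set (SetShYT lam) :=
  {T | (∀ i j, ∀ a ∈ T.entry i j, a < m) ∧ (d = false → T.IsP)}

theorem finite_bounded (d : Bool) (m : ℕ) (lam : StrictPartition) : (bounded d m lam).Finite := by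
  let f : SetShYT lam → (lam.diagram → Finset ℕ) := fun T p => T.entry p.1.1 p.1.2
  have hf : Function.Injective f := by
    intro T U h
    ext1
    funext i j
    by_cases hij : (i, j) ∈ lam.diagram
    · exact congrFun h ⟨(i, j), hij⟩
    · have hT := mt (T.nonempty_iff i j).mp hij
      have hU := mt (U.nonempty_iff i j).mp hij
      rw [Finset.not_nonempty_iff_eq_empty] at hT hU
      rw [hT, hU]
  refine Set.Finite.of_finite_image (f := f) ?_ hf.injOn
  refine (Set.Finite.pi' (t := fun _ : lam.diagram =>
    ((Finset.range m).powerset : Set (Finset ℕ))) fun _ => Finset.finite_toSet _).subset ?_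
  rintro _ ⟨T, hT, rfl⟩ p
  exact Finset.mem_coe.mpr (Finset.mem_powerset.mpr fun a ha =>
    Finset.mem_range.mpr (hT.1 p.1.1 p.1.2 a ha))

/-- The term of the generating function for the tableau `T`. -/
noncomputable def term (T : SetShYT lam) : MvPowerSeries ℕ (Polynomial ℤ) :=
  MvPowerSeries.monomial T.weight (Polynomial.X ^ (T.size - lam.diagram.card))

/-- The generating function of `bounded d m lam`. -/
noncomputable def boundedSeries (d : Bool) (m : ℕ) (lam : StrictPartition) :
    MvPowerSeries ℕ (Polynomial ℤ) :=
  ∑ T ∈ (finite_bounded d m lam).toFinset, T.term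

/-- The parameter `β`. -/
noncomputable def beta : MvPowerSeries ℕ (Polynomial ℤ) := MvPowerSeries.C Polynomial.X

open Classical in
/-- The contribution of the letter `m` to the generating function. -/
noncomputable def letterWeight (d : Bool) (m : ℕ) (U : Finset StrictPartition)
    (lam nu : StrictPartition) : MvPowerSeries ℕ (Polynomial ℤ) :=
  ∑ ka ∈ U, if IsLayer d m lam nu ka then
    MvPowerSeries.X (varIndex m) ^ (lam.diagram.card - ka.diagram.card) *
      beta ^ (nu.diagram.card - ka.diagram.card) else 0

theorem term_addLayer (T : SetShYT nu) (hT : ∀ i j, ∀ a ∈ T.entry i j, a < m)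
    (h : IsLayer d m lam nu ka) : (T.addLayer hT h).term =
      MvPowerSeries.X (varIndex m) ^ (lam.diagram.card - ka.diagram.card) *
        beta ^ (nu.diagram.card - ka.diagram.card) * T.term := by
  rw [term, weight_addLayer, size_addLayer, term, beta, ← map_pow, MvPowerSeries.X_pow_eq,
    ← MvPowerSeries.monomial_zero_eq_C_apply, MvPowerSeries.monomial_mul_monomial,
    MvPowerSeries.monomial_mul_monomial]
  congr 1
  · congr 1
    rw [add_zero, add_comm]
  · ring

open Classical in
theorem boundedSeries_succ {n B : ℕ} (hlam : lam ∈ box n B) :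
    boundedSeries d (m + 1) lam =
      ∑ nu ∈ box n B, letterWeight d m (box n B) lam nu * boundedSeries d m nu := by
  have key : ∀ {nu ka : StrictPartition}, IsLayer d m lam nu ka →
      nu ∈ box n B ∧ ka ∈ box n B := by
    intro nu ka h
    have h1 := h 0
    have h2 := h n
    simp only [LayerRow, mem_box] at *
    omega
  simp only [letterWeight, Finset.sum_mul, ite_mul, zero_mul]
  rw [← Finset.sum_product', ← Finset.sum_filter]
  simp only [boundedSeries, Finset.mul_sum]
  rw [Finset.sum_sigma']
  symm
  refine Finset.sum_bij (fun p hp => p.2.addLayer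
    (((Set.Finite.mem_toFinset _).mp (Finset.mem_sigma.mp hp).2).1)
    (Finset.mem_filter.mp (Finset.mem_sigma.mp hp).1).2) ?_ ?_ ?_ ?_
  · rintro ⟨⟨nu, ka⟩, T⟩ hp
    obtain ⟨h1, h2⟩ := Finset.mem_sigma.mp hp
    rw [Set.Finite.mem_toFinset] at h2 ⊢
    refine ⟨fun i j a ha => ?_, ?_⟩
    · rcases (mem_entry_addLayer _ _ _).mp ha with ha | ha
      · exact (h2.1 i j a ha).trans (Nat.lt_succ_self m)
      · omega
    · rintro rfl
      exact isP_addLayer _ _ _ (h2.2 rfl)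
  · rintro ⟨⟨nu, ka⟩, T⟩ hp ⟨⟨nu', ka'⟩, T'⟩ hp' h
    obtain ⟨rfl, rfl, h1⟩ := addLayer_injective h
    obtain rfl : T = T' := SetShYT.ext h1
    rfl
  · intro T hT
    rw [Set.Finite.mem_toFinset] at hT
    obtain ⟨nu, ka, h, U, hU, hP, rfl⟩ := exists_addLayer T hT.1 hT.2
    refine ⟨⟨⟨nu, ka⟩, U⟩, ?_, rfl⟩
    rw [Finset.mem_sigma, Finset.mem_filter, Finset.mem_product, Set.Finite.mem_toFinset]
    exact ⟨⟨key h, h⟩, hU, hP⟩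
  · rintro ⟨⟨nu, ka⟩, T⟩ hp
    exact (term_addLayer _ _ _).symm

theorem boundedSeries_zero (d : Bool) (lam : StrictPartition) :
    boundedSeries d 0 lam = if lam.part 0 = 0 then 1 else 0 := by
  rw [boundedSeries]
  split_ifs with h
  · have hD : lam.diagram = ∅ := by
      refine Finset.eq_empty_of_forall_notMem ?_
      rintro ⟨i, j⟩ hij
      rw [mem_diagram] at hij
      have := lam.part_anti (Nat.zero_le i)
      omega
    let T : SetShYT lam := ⟨fun _ _ => ∅, by simp [hD], by simp, by simp, by simp, by simp⟩
    rw [Finset.sum_eq_single T]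
    · have h1 : T.weight = 0 := by rw [weight, hD, Finset.sum_empty]
      have h2 : T.size = 0 := by rw [size, hD, Finset.sum_empty]
      rw [term, h1, h2, Nat.zero_sub, pow_zero, MvPowerSeries.monomial_zero_one]
    · intro U hU hne
      refine absurd (SetShYT.ext ?_) hne
      funext i j
      refine Finset.eq_empty_of_forall_notMem fun a ha => ?_
      have := U.mem_diagram_of_mem ha
      rw [hD] at this
      exact Finset.notMem_empty _ this
    · intro hT
      have hT' : T ∈ bounded d 0 lam :=
        ⟨fun i j a ha => absurd ha (Finset.notMem_empty a),
          fun _ i a ha => absurd ha (Finset.notMem_empty a)⟩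
      exact absurd ((Set.Finite.mem_toFinset _).mpr hT') hT
  · refine Finset.sum_eq_zero fun T hT => ?_
    rw [Set.Finite.mem_toFinset] at hT
    have h0 : (0, 0) ∈ lam.diagram := by rw [mem_diagram]; omega
    obtain ⟨a, ha⟩ := (T.nonempty_iff 0 0).mpr h0
    exact absurd (hT.1 0 0 a ha) (Nat.not_lt_zero a)

/-- A tableau whose weight only involves variables below N has all entries below 2 * N, so
truncation does not change this coefficient. -/
theorem coeff_tableauSeries {N : ℕ} {D : ℕ →₀ ℕ} (hD : ∀ i ∈ D.support, i < N)
    {S : Set (SetShYT lam)} (hS : ∀ T, T ∈ S ↔ (d = false → T.IsP)) :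
    MvPowerSeries.coeff D (tableauSeries S) =
      MvPowerSeries.coeff D (boundedSeries d (2 * N) lam) := by
  classical
  change ∑ᶠ T ∈ {T : SetShYT lam | T ∈ S ∧ T.weight = D},
    (Polynomial.X : Polynomial ℤ) ^ (T.size - lam.diagram.card) = _
  have hb : ∀ T : SetShYT lam, T.weight = D → ∀ i j, ∀ a ∈ T.entry i j, a < 2 * N := by
    intro T hT i j a ha
    have hij : (i, j) ∈ lam.diagram := T.mem_diagram_of_mem ha
    have h1 : varIndex a ∈ D.support := by
      rw [Finsupp.mem_support_iff, ← hT, weight, Finsupp.finsetSum_apply]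
      intro h0
      have h2 := (Finset.sum_eq_zero_iff.mp h0) (i, j) hij
      rw [Finsupp.finsetSum_apply] at h2
      have h3 := (Finset.sum_eq_zero_iff.mp h2) a ha
      simp at h3
    have h4 := hD _ h1
    unfold varIndex at h4
    omega
  rw [boundedSeries, map_sum, finsum_mem_eq_finite_toFinset_sum _
    ((finite_weight D).subset fun T hT => hT.2)]
  simp only [term, MvPowerSeries.coeff_monomial]
  rw [← Finset.sum_filter]
  refine Finset.sum_congr ?_ fun _ _ => rfl
  ext T
  simp only [Set.Finite.mem_toFinset, Finset.mem_filter, bounded, Set.mem_ofPred_eq, hS]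
  constructor
  · rintro ⟨h1, h2⟩
    exact ⟨⟨hb T h2, h1⟩, h2.symm⟩
  · rintro ⟨⟨_, h1⟩, h2⟩
    exact ⟨h1, h2.symm⟩

/-! ### Factorization of the weights over rows. -/

section Products

variable {n B : ℕ}

-- Each row condition involves a single part of `ka`, so the parts can be summed independently;
-- strictness of `ka` follows from that of `nu` and the corner condition.
open Classical in
theorem letterWeight_eq_prod (hlam : lam ∈ box n B) (hnu : nu ∈ box n B) :
    letterWeight d m (box n B) lam nu =
      ∏ i ∈ Finset.range n, ∑ k ∈ Finset.range (B + 1),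
        if LayerRow d m (lam.part i) (lam.part (i + 1)) (nu.part i) (nu.part (i + 1)) k then
          MvPowerSeries.X (varIndex m) ^ (lam.part i - k) * beta ^ (nu.part i - k) else 0 := by
  rw [← sum_box_prod, letterWeight]
  · refine Finset.sum_congr rfl fun ka hka => ?_
    rw [Finset.prod_ite_zero]
    have h1 : IsLayer d m lam nu ka ↔ ∀ i ∈ Finset.range n, LayerRow d m (lam.part i)
        (lam.part (i + 1)) (nu.part i) (nu.part (i + 1)) (ka.part i) := by
      refine ⟨fun h i _ => h i, fun h i => ?_⟩
      rcases lt_or_ge i n with hi | hi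
      · exact h i (Finset.mem_range.mpr hi)
      · rw [part_eq_zero_of_mem_box hlam hi, part_eq_zero_of_mem_box hnu hi,
          part_eq_zero_of_mem_box hka hi, part_eq_zero_of_mem_box hlam (hi.trans (Nat.le_succ i))]
        simp [LayerRow]
    by_cases h : IsLayer d m lam nu ka
    · rw [if_pos h, if_pos (h1.mp h), Finset.prod_mul_distrib, Finset.prod_pow_eq_pow_sum, Finset.prod_pow_eq_pow_sum,
        Finset.sum_tsub_distrib _ fun i _ => (h i).1.trans (h i).2.1,
        Finset.sum_tsub_distrib _ fun i _ => (h i).1,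
        card_diagram_eq_sum (mem_box.mp hlam).1, card_diagram_eq_sum (mem_box.mp hnu).1,
        card_diagram_eq_sum (mem_box.mp hka).1]
    · rw [if_neg h, if_neg (mt h1.mpr h)]
  · intro f h0 hf i
    have h2 := nu.isStrictSeq_part i
    have h1 : ∀ j < n, LayerRow d m (lam.part j) (lam.part (j + 1)) (nu.part j)
        (nu.part (j + 1)) (f j) := by
      intro j hj
      by_contra h
      exact hf j hj (if_neg h)
    rcases lt_or_ge i n with hi | hi
    · have h3 := (h1 i hi).2.2.1
      rcases lt_or_ge (i + 1) n with hj | hj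
      · have h4 := (h1 (i + 1) hj).1
        omega
      · rw [h0 _ hj]
        omega
    · rw [h0 _ (hi.trans (Nat.le_succ i))]
      omega

theorem letterWeight_of_even (hm : Even m) (hlam : lam ∈ box n B) (hnu : nu ∈ box n B) :
    letterWeight d m (box n B) lam nu = ∏ i ∈ Finset.range n,
      primedRow (MvPowerSeries.X (varIndex m)) beta d (nu.part i) (nu.part (i + 1))
        (lam.part i) := by
  classical
  rw [letterWeight_eq_prod hlam hnu]
  refine Finset.prod_congr rfl fun i _ => ?_
  have h2 := nu.isStrictSeq_part i
  rw [sum_range_eq_of_support' (a := nu.part i) _ (part_le_of_mem_box hnu i)]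
  · simp only [LayerRow, primedRow, hm, not_true, false_imp_iff, true_imp_iff, and_true]
    generalize lam.part i = l at *
    generalize nu.part i = n at *
    generalize nu.part (i + 1) = n1 at *
    rcases Nat.eq_zero_or_pos n with rfl | hn
    · rcases (show l = 0 ∨ l = 1 ∨ 1 < l by omega) with rfl | rfl | hl
      · simp
      · cases d <;> simp
      · have a : l ≠ 0 := by omega
        have b : l ≠ 1 := by omega
        simp [a, b, hl]
    · have hn0 : n ≠ 0 := by omega
      rcases (show l < n ∨ l = n ∨ l = n + 1 ∨ n + 1 < l by omega) with hl | rfl | rfl | hl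
      · have a : ¬ n ≤ l := by omega
        have b : l ≠ n := by omega
        have c : l ≠ n + 1 := by omega
        simp [a, b, c]
      · have a : l - 1 + 1 = l := by omega
        have b : l - (l - 1) = 1 := by omega
        have c : l - 1 ≠ l := by omega
        have e : (n1 < l - 1 ∨ l - 1 = 0) ∧ (d = false → ¬ l - 1 = 0) ↔
            n1 + 1 < l ∨ d = true ∧ l = 1 := by
          cases d <;> simp <;> omega
        simp [hn0, a, b, c, e, mul_comm]
      · have a : ¬ n + 1 ≤ n - 1 + 1 := by omega
        simp [hn0, a, hn]
      · have a : ¬ l ≤ n + 1 := by omega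
        have b : ¬ l ≤ n - 1 + 1 := by omega
        have c : l ≠ n := by omega
        have e : l ≠ n + 1 := by omega
        simp [a, b, c, e]
  · intro k h3 h4
    refine if_neg fun h => ?_
    have := h.2.2.1
    omega

theorem letterWeight_of_odd (hm : ¬ Even m) (hlam : lam ∈ box n B) (hnu : nu ∈ box n B) :
    letterWeight d m (box n B) lam nu = ∏ i ∈ Finset.range n,
      unprimedRow (MvPowerSeries.X (varIndex m)) beta (lam.part i) (lam.part (i + 1))
        (nu.part i) := by
  classical
  rw [letterWeight_eq_prod hlam hnu]
  -- The factors agree row by row only if `nu` is contained in `lam`, since `unprimedRow` does not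
  -- see the next part of `nu`; otherwise both products vanish.
  by_cases hsub : ∀ i < n, nu.part i ≤ lam.part i
  swap
  · push Not at hsub
    obtain ⟨i, hi, h⟩ := hsub
    have h' : ¬ nu.part i ≤ lam.part i := by omega
    rw [Finset.prod_eq_zero (Finset.mem_range.mpr hi), Finset.prod_eq_zero (Finset.mem_range.mpr hi)]
    · simp [unprimedRow, h']
    · refine Finset.sum_eq_zero fun k _ => if_neg fun hL => h' hL.2.1
  refine Finset.prod_congr rfl fun i hi => ?_
  have h1 := hsub i (Finset.mem_range.mp hi)
  have h2 := nu.isStrictSeq_part i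
  have h3 : nu.part (i + 1) ≤ lam.part (i + 1) := by
    rcases lt_or_ge (i + 1) n with hj | hj
    · exact hsub _ hj
    · rw [part_eq_zero_of_mem_box hnu hj]; omega
  rw [sum_range_eq_of_support' (a := nu.part i) _ (part_le_of_mem_box hnu i)]
  · simp only [LayerRow, unprimedRow, hm, not_false_iff, false_imp_iff, true_imp_iff, true_and]
    generalize lam.part i = l at *
    generalize lam.part (i + 1) = l1 at *
    generalize nu.part i = n at *
    generalize nu.part (i + 1) = n1 at *
    rcases Nat.eq_zero_or_pos n with rfl | hn
    · simp
    · have hn0 : n ≠ 0 := by omega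
      have a : n - 1 + 1 = n := by omega
      have b : l - (n - 1) = l - n + 1 := by omega
      have c : n - 1 ≠ n := by omega
      have f : n - (n - 1) = 1 := by omega
      have e : (n1 < n - 1 ∨ n - 1 = 0) ∧ (l1 < n - 1 ∨ l1 = 0) ↔ l1 + 1 < n ∨ l1 = 0 := by
        omega
      by_cases g : l1 + 1 < n ∨ l1 = 0
      · have g' : l1 < n ∨ l1 = 0 := by omega
        simp [hn0, hn, h1, a, b, c, e, f, g, g']
        ring
      · simp [hn0, h1, a, c, e, g]
  · intro k h3 h4
    refine if_neg fun h => ?_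
    have := h.2.2.1
    omega

theorem boundedSeries_add_two {N : ℕ} (hlam : lam ∈ box n B) :
    boundedSeries d (2 * (N + 1)) lam = ∑ nu ∈ box n B, (∏ i ∈ Finset.range n,
      variableRow (MvPowerSeries.X N) beta d (lam.part i) (lam.part (i + 1)) (nu.part i)
        (nu.part (i + 1))) * boundedSeries d (2 * N) nu := by
  have v1 : varIndex (2 * N + 1) = N := by unfold varIndex; omega
  have v2 : varIndex (2 * N) = N := by unfold varIndex; omega
  have e1 : ¬ Even (2 * N + 1) := by simp
  have e2 : Even (2 * N) := by simp
  rw [show 2 * (N + 1) = 2 * N + 1 + 1 by ring, boundedSeries_succ hlam]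
  have h1 : ∀ rho ∈ box n B, letterWeight d (2 * N + 1) (box n B) lam rho *
      boundedSeries d (2 * N + 1) rho = ∑ nu ∈ box n B, (∏ i ∈ Finset.range n,
        (unprimedRow (MvPowerSeries.X N) beta (lam.part i) (lam.part (i + 1)) (rho.part i) *
        primedRow (MvPowerSeries.X N) beta d (nu.part i) (nu.part (i + 1)) (rho.part i))) *
        boundedSeries d (2 * N) nu := by
    intro rho hrho
    rw [boundedSeries_succ hrho, Finset.mul_sum]
    refine Finset.sum_congr rfl fun nu hnu => ?_
    rw [letterWeight_of_odd e1 hlam hrho, letterWeight_of_even e2 hrho hnu, v1, v2,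
      Finset.prod_mul_distrib, mul_assoc]
  rw [Finset.sum_congr rfl h1, Finset.sum_comm]
  refine Finset.sum_congr rfl fun nu hnu => ?_
  rw [← Finset.sum_mul]
  congr 1
  rw [sum_box_prod (fun i r =>
    unprimedRow (MvPowerSeries.X N) beta (lam.part i) (lam.part (i + 1)) r *
      primedRow (MvPowerSeries.X N) beta d (nu.part i) (nu.part (i + 1)) r)]
  · refine Finset.prod_congr rfl fun i _ => ?_
    have h2 := part_le_of_mem_box hlam i
    have h3 := part_le_of_mem_box hnu i
    have h4 : ∀ r, ¬ r ≤ lam.part i → unprimedRow (MvPowerSeries.X N) beta (lam.part i)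
        (lam.part (i + 1)) r = 0 := by
      intro r hr
      simp [unprimedRow, hr]
    -- The value r = nu_i + 1 may be B + 1, outside the range. The range is enlarged by one; the
    -- added term is zero because r exceeds lam_i.
    have h5 := Finset.sum_range_succ (fun r =>
      unprimedRow (MvPowerSeries.X N) beta (lam.part i) (lam.part (i + 1)) r *
      primedRow (MvPowerSeries.X N) beta d (nu.part i) (nu.part (i + 1)) r) (B + 1)
    rw [h4 (B + 1) (by omega), zero_mul, add_zero] at h5
    rw [← h5, sum_range_eq_of_support (a := nu.part i) _ (by omega), variableRow]
    · ring
    · intro r h6 h7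
      simp [primedRow, h6, h7]
  · intro f h0 hf i
    have h1 : ∀ j < n, f j ≤ lam.part j ∧ (lam.part (j + 1) < f j ∨ lam.part (j + 1) = 0) := by
      intro j hj
      by_contra h
      exact hf j hj (by rw [unprimedRow, if_neg h, zero_mul])
    rcases lt_or_ge i n with hi | hi
    · have h3 := h1 i hi
      rcases lt_or_ge (i + 1) n with hj | hj
      · have h4 := (h1 (i + 1) hj).1
        omega
      · rw [h0 _ hj]
        omega
    · rw [h0 _ (hi.trans (Nat.le_succ i))]
      omega

end Products

end SetShYT

/-! ### Induction on the number of variables. -/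

open StrictPartition SetShYT

/-- Remove the last variable on both sides, expand everything in the `GP` series with one variable
fewer, and compare coefficients by `intertwining`. Without variables only the empty shape survives.
-/
theorem boundedSeries_true_eq_sum (n B N : ℕ) {mu : StrictPartition} (hmu : mu ∈ box n B) :
    boundedSeries true (2 * N) mu = ∑ lam ∈ box n (B + 1), (∏ i ∈ Finset.range n,
      stripRow beta (mu.part i) (mu.part (i + 1)) (lam.part i) (lam.part (i + 1))) *
        boundedSeries false (2 * N) lam := by
  induction N generalizing mu with
  | zero =>
    have hm := mem_box.mp hmu
    simp only [mul_zero, boundedSeries_zero, mul_ite, mul_one]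
    rw [← Finset.sum_filter]
    by_cases h0 : mu.part 0 = 0
    · have hz : ∀ i, mu.part i = 0 := fun i => by
        have := mu.part_anti (Nat.zero_le i)
        omega
      rw [if_pos h0, Finset.sum_eq_single mu]
      · simp [hz, stripRow]
      · intro lam hlam hne
        refine absurd (ext_part fun i => ?_) hne
        have := lam.part_anti (Nat.zero_le i)
        have := (Finset.mem_filter.mp hlam).2
        rw [hz]
        omega
      · intro h
        exact absurd (Finset.mem_filter.mpr ⟨mem_box.mpr ⟨hm.1, by omega⟩, h0⟩) h
    · rw [if_neg h0, Finset.sum_eq_zero]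
      intro lam hlam
      have hn : 0 < n := by
        refine Nat.pos_of_ne_zero ?_
        rintro rfl
        exact h0 hm.1
      refine Finset.prod_eq_zero (Finset.mem_range.mpr hn) ?_
      have := (Finset.mem_filter.mp hlam).2
      exact stripRow_eq_zero_of_ne _ (by omega) (by omega)
  | succ N ih =>
    have hsub : box n B ⊆ box n (B + 1) := by
      intro nu h
      rw [mem_box] at *
      omega
    have e1 : ∀ nu ∈ box n B, (∏ i ∈ Finset.range n, variableRow (MvPowerSeries.X N) beta true
          (mu.part i) (mu.part (i + 1)) (nu.part i) (nu.part (i + 1))) *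
          boundedSeries true (2 * N) nu =
        ∑ ka ∈ box n (B + 1), (∏ i ∈ Finset.range n, variableRow (MvPowerSeries.X N) beta true
          (mu.part i) (mu.part (i + 1)) (nu.part i) (nu.part (i + 1))) *
          (∏ i ∈ Finset.range n,
            stripRow beta (nu.part i) (nu.part (i + 1)) (ka.part i) (ka.part (i + 1))) *
          boundedSeries false (2 * N) ka := by
      intro nu hnu
      rw [ih hnu, Finset.mul_sum]
      simp only [mul_assoc]
    have e2 : ∀ lam ∈ box n (B + 1), (∏ i ∈ Finset.range n,
        stripRow beta (mu.part i) (mu.part (i + 1)) (lam.part i) (lam.part (i + 1))) *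
        boundedSeries false (2 * (N + 1)) lam =
        ∑ ka ∈ box n (B + 1), (∏ i ∈ Finset.range n,
        stripRow beta (mu.part i) (mu.part (i + 1)) (lam.part i) (lam.part (i + 1))) *
        (∏ i ∈ Finset.range n, variableRow (MvPowerSeries.X N) beta false
          (lam.part i) (lam.part (i + 1)) (ka.part i) (ka.part (i + 1))) *
        boundedSeries false (2 * N) ka := by
      intro lam hlam
      rw [boundedSeries_add_two hlam, Finset.mul_sum]
      simp only [mul_assoc]
    rw [boundedSeries_add_two hmu, Finset.sum_congr rfl e1, Finset.sum_congr rfl e2,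
      Finset.sum_comm, Finset.sum_comm (s := box n (B + 1)) (t := box n (B + 1))]
    refine Finset.sum_congr rfl fun ka hka => ?_
    rw [← Finset.sum_mul, ← Finset.sum_mul, ← intertwining _ _ hmu hka]
    congr 1
    refine Finset.sum_subset hsub fun nu h3 h4 => ?_
    -- The bound B + 1 in `intertwining` admits extra shapes `nu`; their first row is longer than
    -- that of `mu`, so their weight is zero.
    have h5 : B < nu.part 0 := by
      by_contra h
      exact h4 (mem_box.mpr ⟨(mem_box.mp h3).1, by omega⟩)
    have hn : 0 < n := by
      refine Nat.pos_of_ne_zero ?_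
      rintro rfl
      have := (mem_box.mp h3).1
      omega
    have h6 := (mem_box.mp hmu).2
    rw [Finset.prod_eq_zero (Finset.mem_range.mpr hn), zero_mul]
    exact variableRow_of_lt _ _ _ (by omega)

theorem map_stripRow {R S : Type*} [CommRing R] [CommRing S] (f : R →+* S) (β : R)
    (m m1 l l1 : ℕ) : f (stripRow β m m1 l l1) = stripRow (f β) m m1 l l1 := by
  simp only [stripRow, apply_ite f, map_one, map_zero, map_neg, map_ofNat]

/-- The expansion of `GQ` with integral coefficients. -/
theorem GQ_eq_sum {n B : ℕ} {mu : StrictPartition} (hmu : mu ∈ box n B) :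
    GQ mu = ∑ lam ∈ box n (B + 1), MvPowerSeries.C (∏ i ∈ Finset.range n,
      stripRow Polynomial.X (mu.part i) (mu.part (i + 1)) (lam.part i) (lam.part (i + 1))) *
        GP lam := by
  refine MvPowerSeries.ext fun D => ?_
  have hD : ∀ i ∈ D.support, i < D.support.sup id + 1 := fun i hi =>
    Nat.lt_succ_of_le (Finset.le_sup (f := id) hi)
  have hQ : ∀ T : SetShYT mu, T ∈ Set.univ ↔ (true = false → T.IsP) := by simp
  have hP : ∀ (lam : StrictPartition) (T : SetShYT lam),
      T ∈ {T : SetShYT lam | T.IsP} ↔ (false = false → T.IsP) := by simp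
  rw [GQ, coeff_tableauSeries hD hQ, boundedSeries_true_eq_sum n B _ hmu, map_sum, map_sum]
  refine Finset.sum_congr rfl fun lam _ => ?_
  have h1 : ∏ i ∈ Finset.range n,
      stripRow beta (mu.part i) (mu.part (i + 1)) (lam.part i) (lam.part (i + 1)) =
      MvPowerSeries.C (∏ i ∈ Finset.range n, stripRow Polynomial.X (mu.part i) (mu.part (i + 1))
        (lam.part i) (lam.part (i + 1))) := by
    rw [map_prod]
    exact Finset.prod_congr rfl fun i _ => (map_stripRow _ _ _ _ _ _).symm
  rw [h1, MvPowerSeries.coeff_C_mul, MvPowerSeries.coeff_C_mul, GP,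
    coeff_tableauSeries hD (hP lam)]

theorem toRat_GQ_eq_sum {n B : ℕ} {mu : StrictPartition} (hmu : mu ∈ box n B) :
    toRat (GQ mu) = ∑ lam ∈ box n (B + 1), (∏ i ∈ Finset.range n,
      stripRow (Polynomial.X : Polynomial ℚ) (mu.part i) (mu.part (i + 1)) (lam.part i)
        (lam.part (i + 1))) • toRat (GP lam) := by
  rw [GQ_eq_sum hmu, map_sum]
  refine Finset.sum_congr rfl fun lam _ => ?_
  rw [map_mul, MvPowerSeries.smul_eq_C_mul]
  congr 1
  rw [toRat, MvPowerSeries.map_C, map_prod]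
  congr 1
  refine Finset.prod_congr rfl fun i _ => ?_
  rw [map_stripRow, Polynomial.coe_mapRingHom, Polynomial.map_X]

/-! ### Row factors in terms of vertical strips and columns. -/

namespace StrictPartition

theorem mem_verticalStripExtensions_iff {mu lam : StrictPartition} :
    lam ∈ mu.verticalStripExtensions ↔
      ∀ i, mu.part i ≤ lam.part i ∧ lam.part i ≤ mu.part i + 1 ∧
        (mu.part i = 0 → lam.part i = 0) := by
  constructor
  · rintro ⟨h1, h2, h3⟩ i
    have h4 : mu.part i ≤ lam.part i := h1 i
    refine ⟨h4, ?_, ?_⟩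
    · by_contra h
      have := h3 i (i + mu.part i) (i + mu.part i + 1)
      simp only [skewDiagram, Finset.mem_sdiff, mem_diagram] at this
      omega
    · rw [part_eq_zero_iff, part_eq_zero_iff, h2]
      exact id
  · intro h
    refine ⟨fun i => (h i).1, ?_, ?_⟩
    · refine le_antisymm ?_ ?_
      · rw [← part_eq_zero_iff]
        exact (h _).2.2 ((mu.part_eq_zero_iff _).mpr le_rfl)
      · rw [← part_eq_zero_iff]
        have := (h lam.length).1
        rw [(lam.part_eq_zero_iff _).mpr le_rfl] at this
        omega
    · intro i j₁ j₂ h1 h2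
      have := h i
      simp only [skewDiagram, Finset.mem_sdiff, mem_diagram] at *
      omega

theorem prod_stripRow_eq_zero {R : Type*} [CommRing R] (β : R) {n : ℕ} {mu lam : StrictPartition}
    (hmu : mu.part n = 0) (hlam : lam.part n = 0) (h : lam ∉ mu.verticalStripExtensions) :
    ∏ i ∈ Finset.range n,
      stripRow β (mu.part i) (mu.part (i + 1)) (lam.part i) (lam.part (i + 1)) = 0 := by
  rw [mem_verticalStripExtensions_iff] at h
  push Not at h
  obtain ⟨i, hi⟩ := h
  have h1 : i < n := by
    by_contra hn
    have := mu.part_anti (not_lt.mp hn)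
    have := lam.part_anti (not_lt.mp hn)
    have := hi (by omega) (by omega)
    omega
  refine Finset.prod_eq_zero (Finset.mem_range.mpr h1) ?_
  by_cases h2 : mu.part i ≤ lam.part i ∧ lam.part i ≤ mu.part i + 1
  · obtain ⟨h3, h4⟩ := hi h2.1 h2.2
    exact stripRow_zero_eq_zero β h3 h4
  · exact stripRow_eq_zero_of_ne β (by omega) (by omega)

/-- The last rows of the columns of `lam / mu`, for a vertical strip. -/
def lastRows (mu lam : StrictPartition) (n : ℕ) : Finset ℕ :=
  (Finset.range n).filter fun i => lam.part i = mu.part i + 1 ∧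
    ¬ (lam.part (i + 1) = mu.part (i + 1) + 1 ∧ mu.part i = mu.part (i + 1) + 1)

theorem skewDiagram_eq_image {mu lam : StrictPartition} (h : lam ∈ mu.verticalStripExtensions) :
    skewDiagram lam mu = ((Finset.range mu.length).filter fun i => lam.part i = mu.part i + 1).image
      fun i => (i, i + mu.part i) := by
  rw [mem_verticalStripExtensions_iff] at h
  ext ⟨i, j⟩
  have h1 := h i
  have h2 := mu.part_eq_zero_iff i
  simp only [skewDiagram, Finset.mem_sdiff, mem_diagram, Finset.mem_image, Finset.mem_filter,
    Finset.mem_range, Prod.mk.injEq]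
  constructor
  · intro h3
    exact ⟨i, by omega, rfl, by omega⟩
  · rintro ⟨a, h3, rfl, rfl⟩
    omega

theorem card_skewDiagram {mu lam : StrictPartition} (h : lam ∈ mu.verticalStripExtensions) :
    (skewDiagram lam mu).card =
      ((Finset.range mu.length).filter fun i => lam.part i = mu.part i + 1).card := by
  rw [skewDiagram_eq_image h, Finset.card_image_of_injective]
  intro i j hij
  exact (Prod.ext_iff.mp hij).1

/-- Each occupied column is counted by its lowest box. -/
theorem cols_eq_card_lastRows {mu lam : StrictPartition} (h : lam ∈ mu.verticalStripExtensions) :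
    cols lam mu = (lastRows mu lam mu.length).card := by
  rw [cols, skewDiagram_eq_image h, Finset.image_image]
  have hmu := fun i => mu.isStrictSeq_part i
  have hlam := fun i => lam.isStrictSeq_part i
  rw [mem_verticalStripExtensions_iff] at h
  have hdec : ∀ i j, i ≤ j → mu.part j ≠ 0 → j + mu.part j ≤ i + mu.part i := by
    intro i j hij h0
    have := mu.part_anti hij
    omega
  have hinj : Set.InjOn (fun i => i + mu.part i) (lastRows mu lam mu.length : Set ℕ) := by
    have key : ∀ i j, i < j → i ∈ lastRows mu lam mu.length → j ∈ lastRows mu lam mu.length →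
        i + mu.part i ≠ j + mu.part j := by
      intro i j hij hi hj he
      simp only [lastRows, Finset.mem_filter, Finset.mem_range] at hi hj
      have a1 := mu.part_eq_zero_iff j
      -- The number i + mu_i decreases weakly along the nonzero parts, so a column shared by rows i
      -- < j is also the one of row i + 1. Strictness of `lam` then forces a new box there, so row i
      -- is not last.
      have a2 := hdec (i + 1) j hij (by omega)
      have a3 := hmu i
      have a4 := h (i + 1)
      have a5 := lam.part_anti (show i + 1 ≤ j from hij)
      omega
    intro i hi j hj he
    rcases lt_trichotomy i j with hij | hij | hij
    · exact absurd he (key i j hij hi hj)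
    · exact hij
    · exact absurd he.symm (key j i hij hj hi)
  rw [← Finset.card_image_of_injOn hinj]
  congr 1
  ext j
  simp only [Finset.mem_image, Function.comp]
  constructor
  · rintro ⟨i, hi, rfl⟩
    obtain ⟨k, hk, hmax⟩ := Finset.exists_max_image (((Finset.range mu.length).filter
      fun i => lam.part i = mu.part i + 1).filter fun k => k + mu.part k = i + mu.part i) id
      ⟨i, Finset.mem_filter.mpr ⟨hi, rfl⟩⟩
    simp only [Finset.mem_filter, Finset.mem_range, id] at hk hmax
    refine ⟨k, ?_, hk.2⟩
    simp only [lastRows, Finset.mem_filter, Finset.mem_range]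
    refine ⟨hk.1.1, hk.1.2, ?_⟩
    rintro ⟨b1, b2⟩
    have b3 := h (k + 1)
    have b4 := mu.part_eq_zero_iff (k + 1)
    have := hmax (k + 1) ⟨⟨by omega, b1⟩, by omega⟩
    omega
  · rintro ⟨i, hi, rfl⟩
    simp only [lastRows, Finset.mem_filter] at hi
    exact ⟨i, Finset.mem_filter.mpr ⟨hi.1, hi.2.1⟩, rfl⟩

theorem prod_stripRow_eq {mu lam : StrictPartition} (h : lam ∈ mu.verticalStripExtensions) :
    ∏ i ∈ Finset.range mu.length, stripRow (Polynomial.X : Polynomial ℚ) (mu.part i)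
      (mu.part (i + 1)) (lam.part i) (lam.part (i + 1)) =
    2 ^ mu.length * ((-1) ^ cols lam mu * negHalfBeta ^ (skewDiagram lam mu).card) := by
  -- With this, each new box contributes -β once its row has supplied a factor 2; the sign attached
  -- to a column turns this into β in its last row.
  have h2 : (2 : Polynomial ℚ) * negHalfBeta = -Polynomial.X := by
    rw [negHalfBeta, ← mul_assoc, ← map_ofNat Polynomial.C 2, ← map_mul]
    norm_num
  rw [cols_eq_card_lastRows h, card_skewDiagram h, ← Finset.card_range mu.length,
    ← Finset.prod_const, ← Finset.prod_const, ← Finset.prod_const, Finset.card_range, lastRows,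
    Finset.prod_filter, Finset.prod_filter, ← Finset.prod_mul_distrib, ← Finset.prod_mul_distrib]
  rw [mem_verticalStripExtensions_iff] at h
  refine Finset.prod_congr rfl fun i hi => ?_
  have a1 := h i
  have a2 := mu.part_eq_zero_iff i
  have a3 := mu.isStrictSeq_part i
  have a4 := lam.isStrictSeq_part i
  have a5 := Finset.mem_range.mp hi
  have c1 : mu.part i ≠ 0 := by omega
  have c2 : ¬ mu.part i ≤ mu.part (i + 1) := by omega
  rw [stripRow, if_neg c1, if_neg c2]
  by_cases b1 : lam.part i = mu.part i + 1
  · by_cases b2 : lam.part (i + 1) = mu.part (i + 1) + 1 ∧ mu.part i = mu.part (i + 1) + 1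
    · rw [if_pos b2, if_pos b1, if_neg (by tauto), if_pos b1, one_mul, h2]
    · rw [if_neg b2, if_pos b1, if_pos ⟨b1, b2⟩, if_pos b1, neg_one_mul, mul_neg, h2, neg_neg]
  -- Otherwise rows i and i + 1 of `lam` would have equal length.
  · have b2 : ¬ (lam.part (i + 1) = mu.part (i + 1) + 1 ∧ mu.part i = mu.part (i + 1) + 1) := by
      omega
    rw [if_neg b2, if_neg b1, if_pos (by omega), if_neg (by tauto), if_neg b1, one_mul, mul_one]

end StrictPartition

theorem theorem1 (mu : StrictPartition) :
    mu.verticalStripExtensions.Finite ∧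
    toRat (GQ mu) =
      (2 : Polynomial ℚ) ^ mu.length •
        ∑ᶠ lam ∈ mu.verticalStripExtensions,
          ((-1 : Polynomial ℚ) ^ StrictPartition.cols lam mu *
              negHalfBeta ^ (StrictPartition.skewDiagram lam mu).card) •
            toRat (GP lam) := by
  classical
  have hmu : mu ∈ box mu.length (mu.part 0) :=
    mem_box.mpr ⟨(mu.part_eq_zero_iff _).mpr le_rfl, le_rfl⟩
  have hsub : mu.verticalStripExtensions ⊆ box mu.length (mu.part 0 + 1) := by
    intro lam h
    rw [mem_verticalStripExtensions_iff] at h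
    exact mem_box.mpr ⟨(h _).2.2 (mem_box.mp hmu).1, (h 0).2.1⟩
  have hfin := (Finset.finite_toSet _).subset hsub
  refine ⟨hfin, ?_⟩
  rw [toRat_GQ_eq_sum hmu, finsum_mem_eq_finite_toFinset_sum _ hfin, Finset.smul_sum]
  symm
  refine Finset.sum_subset_zero_on_sdiff (fun lam h => hsub (hfin.mem_toFinset.mp h)) ?_ ?_
  · intro lam hlam
    obtain ⟨h1, h2⟩ := Finset.mem_sdiff.mp hlam
    rw [prod_stripRow_eq_zero _ (mem_box.mp hmu).1 (mem_box.mp h1).1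
      (mt hfin.mem_toFinset.mpr h2), zero_smul]
  · intro lam hlam
    rw [prod_stripRow_eq (hfin.mem_toFinset.mp hlam), smul_smul]
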